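/- Let $n\ge 0$ be an integer and $p\in[1,\infty]$, with conjugate exponent $p^*$. For $M\in\mathbb R^{n\times n}$ let $|M|_p$ be the Schatten $p$-norm, i.e. the $\ell^p$ norm of the vector of the $n$ singular values of $M$, and let $|M|$ be the Hilbert–Schmidt norm. Let $\Omega\subseteq\mathbb R^n$ be open and $f\in L^1_{\rm loc}(\Omega)$. For $A\subseteq\Omega$ open put $$|{\rm D}^2_pf|(A)=\sup\Big\{\int_A\sum_{i,j=1}^n f\,\partial_i\partial_jF_{i,j}\,dx:\ F\in C_c^\infty(A)^{n\times n},\ \sup_x|F(x)|_{p^*}\le1\Big\}\in[0,\infty],$$ and say that $f$ has bounded $p$-Hessian–Schatten variation in $\Omega$ if $|{\rm D}^2_pf|(\Omega)<\infty$. For $g\in L^1_{\rm loc}(\Omega;\mathbb R^n)$ and $A\subseteq\Omega$ open put $$|{\rm D}g|(A)=\sup\Big\{\int_A\sum_{i,j=1}^n g_i\,\partial_jF_{i,j}\,dx:\ F\in C_c^\infty(A)^{n\times n},\ \sup_x|F(x)|\le1\Big\}\in[0,\infty],$$ and write $g\in{\rm BV}_{\rm loc}(\Omega)$ if $|{\rm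 D}g|(A)<\infty$ for every open $A$ whose closure is a compact subset of $\Omega$. **Proposition.** The following are equivalent: 1. $f$ has bounded $p$-Hessian–Schatten variation in $\Omega$; 2. $f\in W^{1,1}_{\rm loc}(\Omega)$ and $\nabla f\in{\rm BV}_{\rm loc}(\Omega)$ with $|{\rm D}\nabla f|(\Omega)<\infty$. (As condition 2 does not involve $p$, condition 1 does not depend on $p$.) If this is the case, then $|{\rm D}^2_pf|$ is the restriction to the open subsets of $\Omega$ of a finite Borel measure on $\Omega$, still denoted $|{\rm D}^2_pf|$; the distributional derivative of $\nabla f$ is a finite $\mathbb R^{n\times n}$-valued Borel measure ${\rm D}\nabla f$ on $\Omega$, whose total variation measure (with respect to the Hilbert–Schmidt norm) has the value $|{\rm D}\nabla f|(A)$ above on every open $A\subseteq\Omega$; and, as measures on $\Omega$, $$|{\rm D}^2_pf|=\Big|\frac{d\,{\rm D}\nabla f}{d|{\rm D}\nabla f|}\Big|_p\,|{\rm D}\nabla f| .$$ In particular there is a constant $C=C(n,p)>0$, depending only on $n$ and $p$, such that for all such $\Omega$ and $f$, as measures, $$C^{-1}|{\rm D}\nabla f|\le|{\rm D}^2_pf|\le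 C|{\rm D}\nabla f| .$$ -/

import Mathlib

open MeasureTheory TopologicalSpace
open scoped ENNReal NNReal Distributions LineDeriv

noncomputable section

namespace HessianSchatten

/-- `ℝⁿ` with its Euclidean norm. -/
abbrev E (n : ℕ) : Type := EuclideanSpace ℝ (Fin n)

/-- The standard basis vector `e i` of `ℝⁿ`; `∂_{e i} φ` is the `i`-th partial derivative of `φ`. -/
abbrev e {n : ℕ} (i : Fin n) : E n := EuclideanSpace.single i (1 : ℝ)

/-- The space of real `n × n` matrices, normed by the Hilbert-Schmidt norm. -/
abbrev MatHS (n : ℕ) : Type := EuclideanSpace ℝ (Fin n × Fin n)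

/-- The Schatten `p`-norm of a square matrix: the `ℓ^p` norm of the vector of its `n` singular
values, counted with multiplicity. -/
def schattenNorm {n : ℕ} (p : ℝ≥0∞) (M : Matrix (Fin n) (Fin n) ℝ) : ℝ :=
  ‖(WithLp.toLp p fun i : Fin n => (Matrix.toEuclideanLin M).singularValues i :
    PiLp p fun _ : Fin n => ℝ)‖

/-- The value at `x` of a matrix-valued test field `F ∈ C_c^∞(A)^{n × n}`. -/
def fieldAt {n : ℕ} {A : Opens (E n)} (F : Fin n → Fin n → 𝓓(A, ℝ)) (x : E n) :
    Matrix (Fin n) (Fin n) ℝ :=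
  Matrix.of fun i j => F i j x

/-- The `p`-Hessian-Schatten total variation `|D²_p f|(A)` on the open set `A`: the supremum of
`∫_A ∑_{i,j} f ∂_i ∂_j F_{i,j}` over the fields `F ∈ C_c^∞(A)^{n × n}` with `|F(x)|_{p*} ≤ 1`
everywhere (`F` is continuous, so this is the bound on the essential supremum). The field `F = 0`
is admissible, hence truncating the integrals at `0` does not change the supremum. -/
def hessianSchattenVariation {n : ℕ} (p : ℝ≥0∞) (f : E n → ℝ) (A : Opens (E n)) : ℝ≥0∞ :=
  ⨆ (F : Fin n → Fin n → 𝓓(A, ℝ))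
    (_ : ∀ x, schattenNorm (ENNReal.conjExponent p) (fieldAt F x) ≤ 1),
    ENNReal.ofReal (∫ x in (A : Set (E n)), ∑ i, ∑ j, f x * (∂_{e i} (∂_{e j} (F i j))) x)

/-- `f` has bounded `p`-Hessian-Schatten variation in `Ω`. -/
def HasBoundedHessianSchattenVariation {n : ℕ} (p : ℝ≥0∞) (f : E n → ℝ) (Ω : Opens (E n)) : Prop :=
  hessianSchattenVariation p f Ω < ∞

/-- `m` is the measure `|D²_p f|`: the finite Borel measure on `Ω` (seen as a measure on `ℝⁿ`
that vanishes outside `Ω`) whose values on open subsets `A` of `Ω` are `|D²_p f|(A)`. -/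
structure IsHessianSchattenMeasure {n : ℕ} (p : ℝ≥0∞) (f : E n → ℝ) (Ω : Opens (E n))
    (m : Measure (E n)) : Prop where
  finite : IsFiniteMeasure m
  concentrated : m (Ω : Set (E n))ᶜ = 0
  apply_open : ∀ A : Opens (E n), A ≤ Ω → m (A : Set (E n)) = hessianSchattenVariation p f A

/-- `g` is the weak gradient of `f` in `Ω` and lies in `L¹_loc(Ω; ℝⁿ)`. -/
structure IsWeakGradient {n : ℕ} (Ω : Opens (E n)) (f : E n → ℝ) (g : E n → E n) : Prop where
  locallyIntegrable : LocallyIntegrableOn g (Ω : Set (E n)) volume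
  integral_eq : ∀ (φ : 𝓓(Ω, ℝ)) (i : Fin n),
    ∫ x in (Ω : Set (E n)), f x * (∂_{e i} φ) x = -∫ x in (Ω : Set (E n)), g x i * φ x

/-- The total variation `|Dg|(A)` of (the distributional derivative of) a vector field `g` on the
open set `A`: the supremum of `∫_A ∑_{i,j} g_i ∂_j F_{i,j}` over the fields
`F ∈ C_c^∞(A)^{n × n}` whose Hilbert-Schmidt norm is at most `1` everywhere. -/
def totalVariation {n : ℕ} (g : E n → E n) (A : Opens (E n)) : ℝ≥0∞ :=
  ⨆ (F : Fin n → Fin n → 𝓓(A, ℝ))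
    (_ : ∀ x, ‖(WithLp.toLp 2 fun ij : Fin n × Fin n => F ij.1 ij.2 x : MatHS n)‖ ≤ 1),
    ENNReal.ofReal (∫ x in (A : Set (E n)), ∑ i, ∑ j, g x i * (∂_{e j} (F i j)) x)

/-- `g ∈ BV_loc(Ω; ℝⁿ)`: `g` is in `L¹_loc` and its total variation is finite on every open set
that is relatively compact in `Ω`. -/
structure MemBVLoc {n : ℕ} (g : E n → E n) (Ω : Opens (E n)) : Prop where
  locallyIntegrable : LocallyIntegrableOn g (Ω : Set (E n)) volume
  totalVariation_lt_top : ∀ A : Opens (E n), IsCompact (closure (A : Set (E n))) →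
    closure (A : Set (E n)) ⊆ (Ω : Set (E n)) → totalVariation g A < ∞

/-- The distributional derivative of the vector field `g` in `Ω` is the finite matrix-valued Borel
measure `D` on `Ω` (seen as a measure on `ℝⁿ` that vanishes outside `Ω`). The entry `(i, j)` of `D`
is `D_j g_i`. The measure `|D|` is `D.variation`, with respect to the Hilbert-Schmidt norm. -/
structure IsDistributionalDerivative {n : ℕ} (Ω : Opens (E n)) (g : E n → E n)
    (D : VectorMeasure (E n) (MatHS n)) : Prop where
  finite : IsFiniteMeasure D.variation
  concentrated : D.variation (Ω : Set (E n))ᶜ = 0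
  integral_eq : ∀ (φ : 𝓓(Ω, ℝ)) (i j : Fin n),
    ∫ x in (Ω : Set (E n)), g x i * (∂_{e j} φ) x = -(∫ᵛ x, φ x ∂•D) (i, j)

/-- The entry `(i, j)` of a matrix-valued measure, as a signed measure. -/
def entry {n : ℕ} (D : VectorMeasure (E n) (MatHS n)) (i j : Fin n) : SignedMeasure (E n) :=
  D.mapRange (EuclideanSpace.proj (i, j) : MatHS n →L[ℝ] ℝ).toLinearMap.toAddMonoidHom
    (EuclideanSpace.proj (i, j) : MatHS n →L[ℝ] ℝ).continuous

/-- The polar density `dD/d|D|` of a matrix-valued measure `D`: the matrix of the Radon-Nikodym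
derivatives of the entries of `D` with respect to `|D|`. -/
def polarDensity {n : ℕ} (D : VectorMeasure (E n) (MatHS n)) (x : E n) :
    Matrix (Fin n) (Fin n) ℝ :=
  Matrix.of fun i j => (entry D i j).rnDeriv D.variation x

end HessianSchatten

end

/-! The implication from condition 2 to condition 1 is an integration by parts together with the
equivalence of the Hilbert-Schmidt and Schatten norms. The substance lies in the converse and in the
density formula.

Regularity. Testing with fields that have one nonzero entry shows that every `∂_i ∂_j f` is a
functional on test functions bounded for the supremum norm. To reach a gradient that is a function,
average a test function `φ` along a unit vector `v` with weight `h - t`. By Taylor's formula the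
second derivative of this average is `φ(x - hv) + h ∂_v φ(x) - φ(x)`, while its supremum norm is of
order `h²`. Dividing by `h` shows that the difference quotients of `f` differ from the weak
derivative by at most a multiple of `h`, as functionals bounded for the supremum norm
(`integral_add_integral_diffQuot_le`). They are therefore Cauchy in `L¹` on relatively compact
subsets, and the limit is the weak derivative. No mollification of `f` is needed.

Measures. The Hahn-Banach and Riesz theorems turn each bounded functional `∂_i ∂_j f` into a
difference of finite measures (`exists_measure_sub_of_forall_le`), and these assemble into the
matrix measure `D`.

Density formula. After integrating by parts twice, both variations are suprema of `∫ ⟨F, H⟩ d|D|`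
over test fields `F` in a unit ball, where `H` is the polar density up to sign. Such a supremum
equals the integral of the dual norm of `H` (`iSup_ofReal_integral_inner_eq`): a nearly optimal
simple field is smoothed at small loss. The Schatten norms for `p` and `p*` are dual by von
Neumann's trace inequality and its equality case. The two-sided bound is then a pointwise comparison
of norms. -/

namespace HessianSchatten

/-! ### Finite `ℓ^p` norms: substochastic matrices and Hölder duality. -/

section FiniteLp

variable {ι : Type*} [Fintype ι]

/-- `ℓ^q` norms do not increase under doubly substochastic matrices. -/
theorem norm_toLp_le_of_substochastic {q : ℝ≥0∞} (hq : 1 ≤ q) (c : ι → ι → ℝ)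
    (hc : ∀ k i, 0 ≤ c k i) (hrow : ∀ k, ∑ i, c k i ≤ 1) (hcol : ∀ i, ∑ k, c k i ≤ 1)
    (a b : ι → ℝ) (h : ∀ k, |a k| ≤ ∑ i, c k i * |b i|) :
    ‖(WithLp.toLp q a : PiLp q fun _ : ι => ℝ)‖ ≤ ‖(WithLp.toLp q b : PiLp q fun _ : ι => ℝ)‖ := by
  have : Fact (1 ≤ q) := ⟨hq⟩
  rcases eq_or_ne q ∞ with rfl | hq'
  · rw [PiLp.norm_eq_ciSup]
    refine Real.iSup_le (fun k => ?_) (norm_nonneg _)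
    calc ‖a k‖ ≤ ∑ i, c k i * |b i| := h k
      _ ≤ ∑ i, c k i * ‖(WithLp.toLp ∞ b : PiLp ∞ fun _ : ι => ℝ)‖ := by
          gcongr with i
          · exact hc k i
          · exact PiLp.norm_apply_le (WithLp.toLp ∞ b : PiLp ∞ fun _ : ι => ℝ) i
      _ ≤ 1 * ‖(WithLp.toLp ∞ b : PiLp ∞ fun _ : ι => ℝ)‖ := by
          rw [← Finset.sum_mul]
          gcongr
          exact hrow k
      _ = _ := one_mul _
  · have hr : 1 ≤ q.toReal := by
      simpa using ENNReal.toReal_mono hq' hq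
    have hr0 : 0 < q.toReal := by linarith
    rw [PiLp.norm_eq_sum hr0, PiLp.norm_eq_sum hr0]
    simp only [Real.norm_eq_abs]
    have hS : ∀ k, 0 ≤ ∑ i, c k i * |b i| ^ q.toReal := fun k =>
      Finset.sum_nonneg fun i _ => mul_nonneg (hc k i) (by positivity)
    apply Real.rpow_le_rpow (Finset.sum_nonneg fun i _ => by positivity) _ (by positivity)
    calc ∑ k, |a k| ^ q.toReal ≤ ∑ k, ∑ i, c k i * |b i| ^ q.toReal := by
          gcongr with k
          -- Weighted power mean inequality. Row sums at most `1` let the total weight be dropped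
          -- here; the column sums enter after the order of summation is exchanged.
          have h1 : |a k| ≤ (∑ i, c k i * |b i| ^ q.toReal) ^ q.toReal⁻¹ :=
            calc |a k| ≤ ∑ i, c k i * |b i| := h k
              _ ≤ (∑ i, c k i) ^ (1 - q.toReal⁻¹) * (∑ i, c k i * |b i| ^ q.toReal) ^ q.toReal⁻¹ :=
                Real.inner_le_weight_mul_Lp_of_nonneg _ hr _ _ (hc k) fun i => abs_nonneg _
              _ ≤ 1 * (∑ i, c k i * |b i| ^ q.toReal) ^ q.toReal⁻¹ := by
                gcongr
                · exact Real.rpow_nonneg (hS k) _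
                · exact Real.rpow_le_one (Finset.sum_nonneg fun i _ => hc k i) (hrow k)
                    (sub_nonneg.2 (inv_le_one_of_one_le₀ hr))
              _ = _ := one_mul _
          calc |a k| ^ q.toReal ≤ ((∑ i, c k i * |b i| ^ q.toReal) ^ q.toReal⁻¹) ^ q.toReal := by
                gcongr
            _ = _ := Real.rpow_inv_rpow (hS k) hr0.ne'
      _ = ∑ i, (∑ k, c k i) * |b i| ^ q.toReal := by
          rw [Finset.sum_comm]
          simp only [Finset.sum_mul]
      _ ≤ ∑ i, 1 * |b i| ^ q.toReal := by
          gcongr with i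
          exact hcol i
      _ = _ := by simp

theorem sum_mul_le_norm_one_mul_norm_top (a b : ι → ℝ) :
    ∑ i, a i * b i ≤ ‖(WithLp.toLp 1 a : PiLp 1 fun _ : ι => ℝ)‖ *
      ‖(WithLp.toLp ∞ b : PiLp ∞ fun _ : ι => ℝ)‖ := by
  rw [PiLp.norm_eq_of_L1, Finset.sum_mul]
  refine Finset.sum_le_sum fun i _ => ?_
  calc a i * b i ≤ |a i| * |b i| := (le_abs_self _).trans (abs_mul _ _).le
    _ ≤ _ := mul_le_mul_of_nonneg_left
      (PiLp.norm_apply_le (WithLp.toLp ∞ b : PiLp ∞ fun _ : ι => ℝ) i) (abs_nonneg _)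

/-- The `PiLp` norm has a different formula at the exponent `∞`, so the endpoint pairs are separated
from the pairs of finite exponents. -/
theorem holderConjugate_cases {p q : ℝ≥0∞} (h : p.HolderConjugate q) :
    (p = 1 ∧ q = ∞) ∨ (p = ∞ ∧ q = 1) ∨
      (0 < p.toReal ∧ 0 < q.toReal ∧ p.toReal.HolderConjugate q.toReal) := by
  have := h
  have hp1 : 1 ≤ p := ENNReal.HolderConjugate.one_le p q
  have hq := ENNReal.HolderConjugate.conj_eq (p := p) (q := q)
  rcases eq_or_ne p ∞ with rfl | hp
  · exact Or.inr (Or.inl ⟨rfl, by simpa using hq⟩)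
  rcases hp1.eq_or_lt with rfl | hp1
  · exact Or.inl ⟨rfl, by simpa using hq⟩
  · have h1 : 1 < p.toReal := by simpa using (ENNReal.toReal_lt_toReal (by simp) hp).2 hp1
    have := ENNReal.HolderConjugate.toReal (q := q) h1
    exact Or.inr (Or.inr ⟨this.pos, this.symm.pos, this⟩)

theorem sum_mul_le_norm_mul_norm {p q : ℝ≥0∞} (h : p.HolderConjugate q) (a b : ι → ℝ) :
    ∑ i, a i * b i ≤ ‖(WithLp.toLp p a : PiLp p fun _ : ι => ℝ)‖ *
      ‖(WithLp.toLp q b : PiLp q fun _ : ι => ℝ)‖ := by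
  rcases holderConjugate_cases h with ⟨rfl, rfl⟩ | ⟨rfl, rfl⟩ | ⟨hp, hq, hpq⟩
  · exact sum_mul_le_norm_one_mul_norm_top a b
  · simpa only [mul_comm] using sum_mul_le_norm_one_mul_norm_top b a
  · rw [PiLp.norm_eq_sum hp, PiLp.norm_eq_sum hq]
    exact Real.inner_le_Lp_mul_Lq _ _ _ hpq

/-- The equality case of Hölder. The extremizer is the constant `1` for `p = 1`, a unit mass at a
largest coordinate for `p = ∞`, and comes from `NNReal.isGreatest_Lp` otherwise. Nonnegative `a`
suffices because `a` will be a vector of singular values. -/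
theorem exists_norm_le_one_sum_mul_eq_norm {p q : ℝ≥0∞} (h : p.HolderConjugate q) (a : ι → ℝ)
    (ha : ∀ i, 0 ≤ a i) :
    ∃ b : ι → ℝ, ‖(WithLp.toLp q b : PiLp q fun _ : ι => ℝ)‖ ≤ 1 ∧
      ∑ i, a i * b i = ‖(WithLp.toLp p a : PiLp p fun _ : ι => ℝ)‖ := by
  classical
  rcases holderConjugate_cases h with ⟨rfl, rfl⟩ | ⟨rfl, rfl⟩ | ⟨hp, hq, hpq⟩
  · refine ⟨fun _ => 1, ?_, ?_⟩
    · rw [PiLp.norm_eq_ciSup]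
      exact Real.iSup_le (fun i => by simp) zero_le_one
    · rw [PiLp.norm_eq_of_L1]
      simp [abs_of_nonneg (ha _)]
  · rw [PiLp.norm_eq_ciSup]
    cases isEmpty_or_nonempty ι
    · exact ⟨0, by simp, by simp⟩
    · obtain ⟨i, hi⟩ := exists_eq_ciSup_of_finite (f := fun i => ‖a i‖)
      refine ⟨Pi.single i 1, ?_, ?_⟩
      · rw [PiLp.norm_eq_of_L1]
        simp [Pi.single_apply, apply_ite abs]
      · rw [← hi]
        simp [Pi.single_apply, abs_of_nonneg (ha i)]
  · obtain ⟨g, hg, hg'⟩ := (NNReal.isGreatest_Lp Finset.univ (fun i => (a i).toNNReal) hpq).1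
    refine ⟨fun i => g i, ?_, ?_⟩
    · rw [PiLp.norm_eq_sum hq]
      refine Real.rpow_le_one (by positivity) ?_ (by positivity)
      have : ∑ i, g i ^ q.toReal ≤ 1 := hg
      simpa using NNReal.coe_le_coe.2 this
    · rw [PiLp.norm_eq_sum hp]
      have := congrArg ((↑) : ℝ≥0 → ℝ) hg'
      simp only [NNReal.coe_sum, NNReal.coe_mul, NNReal.coe_rpow, Real.coe_toNNReal _ (ha _)]
        at this
      simpa only [Real.norm_eq_abs, abs_of_nonneg (ha _)] using this

end FiniteLp

/-! ### Singular values and duality of Schatten norms. -/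

/-- The singular value decomposition of an endomorphism of `ℝⁿ`. -/
theorem exists_singularValueDecomposition {n : ℕ} (T : E n →ₗ[ℝ] E n) :
    ∃ u v : OrthonormalBasis (Fin n) ℝ (E n), ∀ i : Fin n, T (v i) = T.singularValues i • u i := by
  classical
  have hn : Module.finrank ℝ (E n) = n := by simp
  set v := T.isSymmetric_adjoint_comp_self.eigenvectorBasis hn with hv
  have hin : ∀ i j : Fin n, inner ℝ (T (v i)) (T (v j)) =
      if i = j then T.singularValues j ^ 2 else 0 := by
    intro i j
    have h1 := T.isSymmetric_adjoint_comp_self.apply_eigenvectorBasis hn j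
    rw [← T.sq_singularValues_fin hn j, ← hv] at h1
    rw [← LinearMap.adjoint_inner_right, ← LinearMap.comp_apply, h1]
    rw [inner_smul_right, orthonormal_iff_ite.1 v.orthonormal]
    simp
  -- The images under `T` of an eigenbasis of `T* T` are orthogonal with norms the singular values.
  -- Normalizing the nonzero ones gives an orthonormal family, which is completed to a basis; where
  -- the singular value vanishes, so does `T (v i)`.
  let w : Fin n → E n := fun i => (T.singularValues i)⁻¹ • T (v i)
  let s : Set (Fin n) := {i | T.singularValues i ≠ 0}
  have hw : Orthonormal ℝ (s.domRestrict w) := by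
    rw [orthonormal_iff_ite]
    rintro ⟨i, hi⟩ ⟨j, hj⟩
    simp only [Set.domRestrict_apply, w, inner_smul_left, inner_smul_right, hin, Subtype.mk.injEq]
    split_ifs with hij
    · subst hij
      have : T.singularValues i ≠ 0 := hi
      simp only [conj_trivial]
      field_simp
    · simp
  obtain ⟨u, hu⟩ := hw.exists_orthonormalBasis_extension_of_card_eq (by simp)
  refine ⟨u, v, fun i => ?_⟩
  by_cases hi : T.singularValues i = 0
  · have := hin i i
    rw [if_pos rfl, hi, real_inner_self_eq_norm_sq] at this
    rw [hi, zero_smul, ← norm_eq_zero]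
    simpa using this
  · rw [hu i hi, smul_smul, mul_inv_cancel₀ hi, one_smul]

/-- Both sides are the trace of `Mᵀ B`, which can be computed in any orthonormal basis. -/
theorem sum_mul_eq_sum_inner {n : ℕ} (v : OrthonormalBasis (Fin n) ℝ (E n))
    (M B : Matrix (Fin n) (Fin n) ℝ) :
    ∑ i, ∑ j, M i j * B i j =
      ∑ k, inner ℝ (Matrix.toEuclideanLin M (v k)) (Matrix.toEuclideanLin B (v k)) := by
  have key : ∀ w : OrthonormalBasis (Fin n) ℝ (E n),
      ∑ k, inner ℝ (Matrix.toEuclideanLin M (w k)) (Matrix.toEuclideanLin B (w k)) =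
      LinearMap.trace ℝ (E n) ((Matrix.toEuclideanLin M).adjoint ∘ₗ Matrix.toEuclideanLin B) := by
    intro w
    rw [LinearMap.trace_eq_sum_inner _ w]
    simp [LinearMap.adjoint_inner_right]
  rw [key v, ← key (EuclideanSpace.basisFun (Fin n) ℝ), Finset.sum_comm]
  refine Finset.sum_congr rfl fun j _ => ?_
  simp [PiLp.inner_apply, mul_comm]

/-- Comparing the diagonal of an operator in two orthonormal bases with its diagonal form. -/
theorem norm_toLp_inner_le {n : ℕ} {q : ℝ≥0∞} (hq : 1 ≤ q) (S : E n →ₗ[ℝ] E n)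
    (u v x y : OrthonormalBasis (Fin n) ℝ (E n)) (b : Fin n → ℝ) (h : ∀ i, S (v i) = b i • u i) :
    ‖(WithLp.toLp q fun k => inner ℝ (x k) (S (y k)) : PiLp q fun _ : Fin n => ℝ)‖ ≤
      ‖(WithLp.toLp q b : PiLp q fun _ : Fin n => ℝ)‖ := by
  have hCS : ∀ f g : Fin n → ℝ, (∀ i, 0 ≤ f i) → (∀ i, 0 ≤ g i) → ∑ i, f i ^ 2 = 1 →
      ∑ i, g i ^ 2 = 1 → ∑ i, f i * g i ≤ 1 := by
    intro f g hf hg h1 h2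
    have := Finset.sum_mul_sq_le_sq_mul_sq Finset.univ f g
    rw [h1, h2] at this
    nlinarith [Finset.sum_nonneg fun i (_ : i ∈ Finset.univ) => mul_nonneg (hf i) (hg i)]
  -- Expanding `S (y k)` through `v` and `u` bounds the diagonal by this matrix applied to `|b|`.
  -- Its row and column sums are at most `1` by Cauchy-Schwarz and Parseval.
  refine norm_toLp_le_of_substochastic hq (fun k i => |inner ℝ (x k) (u i)| * |inner ℝ (v i) (y k)|)
    (fun k i => by positivity) (fun k => ?_) (fun i => ?_) _ _ fun k => ?_
  · refine hCS _ _ (fun _ => abs_nonneg _) (fun _ => abs_nonneg _) ?_ ?_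
    · simpa using u.sum_sq_norm_inner_left (x k)
    · simpa using v.sum_sq_norm_inner_right (y k)
  · refine hCS _ _ (fun _ => abs_nonneg _) (fun _ => abs_nonneg _) ?_ ?_
    · simpa using x.sum_sq_norm_inner_right (u i)
    · simpa using y.sum_sq_norm_inner_left (v i)
  · have h1 : S (y k) = ∑ i, (inner ℝ (v i) (y k) * b i) • u i := by
      conv_lhs => rw [← v.sum_repr' (y k)]
      simp [h, smul_smul]
    rw [h1, inner_sum]
    refine (Finset.abs_sum_le_sum_abs _ _).trans (le_of_eq ?_)
    refine Finset.sum_congr rfl fun i _ => ?_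
    rw [inner_smul_right, abs_mul, abs_mul]
    ring

/-- The singular values of `B` are its diagonal in a pair of singular bases, so `norm_toLp_inner_le`
applies. The `b i` may have any sign and order. -/
theorem schattenNorm_le_of_apply_eq {n : ℕ} {q : ℝ≥0∞} (hq : 1 ≤ q) (B : Matrix (Fin n) (Fin n) ℝ)
    (u v : OrthonormalBasis (Fin n) ℝ (E n)) (b : Fin n → ℝ)
    (h : ∀ i, Matrix.toEuclideanLin B (v i) = b i • u i) :
    schattenNorm q B ≤ ‖(WithLp.toLp q b : PiLp q fun _ : Fin n => ℝ)‖ := by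
  obtain ⟨x, y, hxy⟩ := exists_singularValueDecomposition (Matrix.toEuclideanLin B)
  have := norm_toLp_inner_le hq (Matrix.toEuclideanLin B) u v x y b h
  rw [schattenNorm]
  convert this using 4 with k
  rw [hxy, inner_smul_right, real_inner_self_eq_norm_sq]
  simp

section Duality

variable {n : ℕ} {p q : ℝ≥0∞}

/-- Von Neumann's trace inequality with Hölder: in singular bases of `M` the pairing becomes the
singular values of `M` against a diagonal of `B`, and that diagonal has `ℓ^q` norm at most the
Schatten norm of `B`. -/
theorem sum_mul_le_schattenNorm_mul (h : p.HolderConjugate q) (M B : Matrix (Fin n) (Fin n) ℝ) :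
    ∑ i, ∑ j, M i j * B i j ≤ schattenNorm p M * schattenNorm q B := by
  have := h
  have : Fact (1 ≤ q) := ⟨ENNReal.HolderConjugate.one_le q p⟩
  have : Fact (1 ≤ p) := ⟨ENNReal.HolderConjugate.one_le p q⟩
  obtain ⟨u, v, huv⟩ := exists_singularValueDecomposition (Matrix.toEuclideanLin M)
  obtain ⟨x, y, hxy⟩ := exists_singularValueDecomposition (Matrix.toEuclideanLin B)
  rw [sum_mul_eq_sum_inner v]
  calc _ = ∑ k : Fin n, (Matrix.toEuclideanLin M).singularValues k *
        inner ℝ (u k) (Matrix.toEuclideanLin B (v k)) := by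
        simp [huv, inner_smul_left]
    _ ≤ _ := sum_mul_le_norm_mul_norm h _ _
    _ ≤ _ := mul_le_mul_of_nonneg_left
        (norm_toLp_inner_le (Fact.out) _ x y u v _ hxy) (norm_nonneg _)

/-- The optimal `B` has the singular vectors of `M`, with the singular values replaced by a Hölder
extremizer for them. -/
theorem exists_schattenNorm_le_one_sum_mul_eq (h : p.HolderConjugate q)
    (M : Matrix (Fin n) (Fin n) ℝ) :
    ∃ B : Matrix (Fin n) (Fin n) ℝ, schattenNorm q B ≤ 1 ∧
      ∑ i, ∑ j, M i j * B i j = schattenNorm p M := by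
  have := h
  obtain ⟨u, v, huv⟩ := exists_singularValueDecomposition (Matrix.toEuclideanLin M)
  obtain ⟨b, hb, hb'⟩ := exists_norm_le_one_sum_mul_eq_norm h
    (fun i : Fin n => (Matrix.toEuclideanLin M).singularValues i)
    fun i => (Matrix.toEuclideanLin M).singularValues_nonneg i
  refine ⟨Matrix.toEuclideanLin.symm (v.toBasis.constr ℝ fun i => b i • u i), ?_, ?_⟩
  · refine (schattenNorm_le_of_apply_eq (ENNReal.HolderConjugate.one_le q p) _ u v b
      fun i => ?_).trans hb
    rw [LinearEquiv.apply_symm_apply]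
    simp
  · rw [sum_mul_eq_sum_inner v, LinearEquiv.apply_symm_apply, schattenNorm, ← hb']
    refine Finset.sum_congr rfl fun i _ => ?_
    have := v.toBasis.constr_basis ℝ (fun i => b i • u i) i
    rw [OrthonormalBasis.coe_toBasis] at this
    rw [this, huv, inner_smul_left, inner_smul_right, real_inner_self_eq_norm_sq]
    simp

theorem schattenNorm_nonneg (hp : 1 ≤ p) (M : Matrix (Fin n) (Fin n) ℝ) : 0 ≤ schattenNorm p M := by
  have : Fact (1 ≤ p) := ⟨hp⟩
  exact norm_nonneg _

/-- Obtained from duality, which avoids relating the singular values of `t • M` to those of `M`.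
This inequality is all that the rescaling arguments use. -/
theorem schattenNorm_smul_le (h : p.HolderConjugate q) {t : ℝ} (ht : 0 ≤ t)
    (M : Matrix (Fin n) (Fin n) ℝ) : schattenNorm p (t • M) ≤ t * schattenNorm p M := by
  have := h
  obtain ⟨B, hB, hB'⟩ := exists_schattenNorm_le_one_sum_mul_eq h (t • M)
  calc schattenNorm p (t • M) = t * ∑ i, ∑ j, M i j * B i j := by
        rw [← hB']
        simp [Finset.mul_sum, mul_assoc]
    _ ≤ t * (schattenNorm p M * schattenNorm q B) := by
        gcongr
        exact sum_mul_le_schattenNorm_mul h M B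
    _ ≤ t * (schattenNorm p M * 1) := by
        gcongr
        exact schattenNorm_nonneg (ENNReal.HolderConjugate.one_le p q) M
    _ = _ := by ring

/-- The Hilbert-Schmidt norm is the `ℓ²` norm of the singular values. -/
theorem sum_sq_singularValues (M : Matrix (Fin n) (Fin n) ℝ) :
    ∑ i : Fin n, (Matrix.toEuclideanLin M).singularValues i ^ 2 = ∑ i, ∑ j, M i j ^ 2 := by
  obtain ⟨u, v, huv⟩ := exists_singularValueDecomposition (Matrix.toEuclideanLin M)
  have := sum_mul_eq_sum_inner v M M
  simp only [huv, inner_smul_left, inner_smul_right, real_inner_self_eq_norm_sq] at this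
  simp only [sq, this]
  simp

/-- The constant `n` is not sharp: `ℓ²` is at most `ℓ¹`, and each of the `n` coordinates is at most
the `ℓ^p` norm. -/
theorem sqrt_sum_sq_le_schattenNorm (hp : 1 ≤ p) (M : Matrix (Fin n) (Fin n) ℝ) :
    √(∑ i, ∑ j, M i j ^ 2) ≤ n * schattenNorm p M := by
  have : Fact (1 ≤ p) := ⟨hp⟩
  rw [← sum_sq_singularValues]
  have h0 : ∀ i : Fin n, 0 ≤ (Matrix.toEuclideanLin M).singularValues i :=
    fun i => LinearMap.singularValues_nonneg _ _
  calc _ ≤ ∑ i : Fin n, (Matrix.toEuclideanLin M).singularValues i := by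
        refine Real.sqrt_le_iff.2 ⟨Finset.sum_nonneg fun i _ => h0 i, ?_⟩
        exact Finset.sum_sq_le_sq_sum_of_nonneg fun i _ => h0 i
    _ ≤ ∑ i : Fin n, schattenNorm p M := by
        gcongr with i
        exact (le_abs_self _).trans (PiLp.norm_apply_le (WithLp.toLp p fun i : Fin n =>
          (Matrix.toEuclideanLin M).singularValues i : PiLp p fun _ : Fin n => ℝ) i)
    _ = _ := by simp

theorem schattenNorm_le_sqrt_sum_sq (hp : 1 ≤ p) (M : Matrix (Fin n) (Fin n) ℝ) :
    schattenNorm p M ≤ n * √(∑ i, ∑ j, M i j ^ 2) := by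
  have : Fact (1 ≤ p) := ⟨hp⟩
  rw [← sum_sq_singularValues]
  have h0 : ∀ i : Fin n, 0 ≤ (Matrix.toEuclideanLin M).singularValues i :=
    fun i => LinearMap.singularValues_nonneg _ _
  have hsum : (WithLp.toLp p fun i : Fin n => (Matrix.toEuclideanLin M).singularValues i :
      PiLp p fun _ : Fin n => ℝ) =
      ∑ i : Fin n, PiLp.single p i ((Matrix.toEuclideanLin M).singularValues i) := by
    ext j
    simp [Pi.single_apply]
  rw [schattenNorm, hsum]
  refine (norm_sum_le _ _).trans ?_
  calc _ ≤ ∑ i : Fin n, √(∑ i : Fin n, (Matrix.toEuclideanLin M).singularValues i ^ 2) := by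
        gcongr with i
        rw [PiLp.norm_single, Real.norm_eq_abs, ← Real.sqrt_sq_eq_abs]
        exact Real.sqrt_le_sqrt (Finset.single_le_sum
          (f := fun i : Fin n => (Matrix.toEuclideanLin M).singularValues i ^ 2)
          (fun i _ => sq_nonneg _) (Finset.mem_univ i))
    _ = _ := by simp

end Duality


/-! ### Smooth cutoffs and disjoint neighbourhoods of compact sets. -/

open scoped ContDiff Manifold in
theorem exists_contDiff_one_of_isCompact {n : ℕ} {K U : Set (E n)} (hK : IsCompact K)
    (hU : IsOpen U) (hKU : K ⊆ U) :
    ∃ χ : E n → ℝ, ContDiff ℝ ∞ χ ∧ HasCompactSupport χ ∧ tsupport χ ⊆ U ∧ (∀ x ∈ K, χ x = 1) ∧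
      ∀ x, 0 ≤ χ x ∧ χ x ≤ 1 := by
  obtain ⟨L, hL, hKL, hLU⟩ := exists_compact_between hK hU hKU
  obtain ⟨f, hf0, hf1, hf⟩ := exists_contMDiffMap_zero_one_of_isClosed 𝓘(ℝ, E n) (n := ⊤)
    (s := (interior L)ᶜ) (t := K) isOpen_interior.isClosed_compl hK.isClosed
    (Set.disjoint_compl_left_iff_subset.2 hKL)
  have hsub : tsupport f ⊆ L := by
    refine closure_minimal (fun x hx => ?_) hL.isClosed
    by_contra hxL
    exact hx (hf0 fun h => hxL (interior_subset h))
  exact ⟨f, f.contMDiff.contDiff, hL.of_isClosed_subset (isClosed_tsupport _) hsub,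
    hsub.trans hLU, fun x hx => hf1 hx, hf⟩

theorem exists_pairwise_disjoint_open_of_isCompact {X ι : Type*} [TopologicalSpace X] [T2Space X]
    [Finite ι] {K : ι → Set X} (hK : ∀ i, IsCompact (K i))
    (hd : Pairwise fun i j => Disjoint (K i) (K j)) :
    ∃ U : ι → Set X, (∀ i, IsOpen (U i)) ∧ (∀ i, K i ⊆ U i) ∧
      Pairwise fun i j => Disjoint (U i) (U j) := by
  have h : ∀ i j, ∃ U W : Set X, IsOpen U ∧ IsOpen W ∧ K i ⊆ U ∧ K j ⊆ W ∧ (i ≠ j → Disjoint U W) := by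
    intro i j
    by_cases hij : i = j
    · exact ⟨Set.univ, Set.univ, isOpen_univ, isOpen_univ, Set.subset_univ _, Set.subset_univ _,
        fun h => absurd hij h⟩
    · obtain ⟨U, W, hU, hW, hKU, hKW, hUW⟩ :=
        SeparatedNhds.of_isCompact_isCompact (hK i) (hK j) (hd hij)
      exact ⟨U, W, hU, hW, hKU, hKW, fun _ => hUW⟩
  choose U W hU hW hKU hKW hUW using h
  -- The pair `(i, j)` and the pair `(j, i)` are separated independently, so each neighbourhood must
  -- respect both choices. The diagonal pairs impose nothing.
  refine ⟨fun i => ⋂ j, U i j ∩ W j i, fun i => ?_, fun i => ?_, fun i j hij => ?_⟩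
  · exact isOpen_iInter_of_finite fun j => (hU i j).inter (hW j i)
  · exact Set.subset_iInter fun j => Set.subset_inter (hKU i j) (hKW j i)
  · refine (hUW i j hij).mono ?_ ?_
    · exact (Set.iInter_subset _ j).trans Set.inter_subset_left
    · exact (Set.iInter_subset _ i).trans Set.inter_subset_right

/-! ### Interchanging a supremum over test fields with an integral. -/

section SupportFunction

variable {n : ℕ} {V : Type*} [NormedAddCommGroup V] [InnerProductSpace ℝ V]

open scoped ContDiff in
/-- A simple function with values in a set `B` that is star-shaped about the origin can be replaced
by a test field with values in `B`, at an arbitrarily small loss. -/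
theorem exists_contDiff_integral_inner_ge {μ : Measure (E n)} {H : E n → V} (hH : Integrable H μ)
    {A : Set (E n)} (hA : IsOpen A) (hμA : ∀ᵐ x ∂μ, x ∈ A) {B : Set V} (hB0 : (0 : V) ∈ B)
    (hB : ∀ v ∈ B, ∀ t : ℝ, 0 ≤ t → t ≤ 1 → t • v ∈ B)
    (β : SimpleFunc (E n) V) (hβ : ∀ x, β x ∈ B) {ε : ℝ} (hε : 0 < ε) :
    ∃ φ : E n → V, ContDiff ℝ ∞ φ ∧ HasCompactSupport φ ∧ tsupport φ ⊆ A ∧ (∀ x, φ x ∈ B) ∧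
      ∫ x, inner ℝ (β x) (H x) ∂μ - ε ≤ ∫ x, inner ℝ (φ x) (H x) ∂μ := by
  classical
  obtain ⟨R, hR⟩ := β.exists_forall_norm_le
  have hR0 : 0 ≤ R := (norm_nonneg _).trans (hR 0)
  -- Weighting by `‖H‖` makes `ν` finite and makes the `ν`-measure of a set control the error in the
  -- pairing there.
  let ν : Measure (E n) := μ.withDensity fun x => ‖H x‖ₑ
  have : IsFiniteMeasure ν := isFiniteMeasure_withDensity hH.2.ne
  set N : ℝ := (β.range.card : ℝ) with hN
  have hN0 : 0 ≤ N := Nat.cast_nonneg _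
  -- The total loss is at most `2 * R * (N * δ)`; the added ones keep the denominator positive when
  -- `R` or `N` vanishes.
  set δ : ℝ := ε / ((2 * R + 1) * (N + 1)) with hδ
  have hδ0 : 0 < δ := by positivity
  have hS : ∀ v : β.range, MeasurableSet (β ⁻¹' {v.1} ∩ A) := fun v =>
    (β.measurableSet_fiber v.1).inter hA.measurableSet
  have hK : ∀ v : β.range, ∃ K ⊆ β ⁻¹' {v.1} ∩ A, IsCompact K ∧
      ν ((β ⁻¹' {v.1} ∩ A) \ K) < ENNReal.ofReal δ := fun v =>
    (hS v).exists_isCompact_sdiff_lt (measure_ne_top _ _) (by simpa using hδ0)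
  choose K hKS hKc hKν using hK
  obtain ⟨U, hU, hKU, hUd⟩ := exists_pairwise_disjoint_open_of_isCompact hKc (by
    intro v w hvw
    refine Set.disjoint_left.2 fun x hx hx' => hvw (Subtype.ext ?_)
    exact ((hKS v hx).1 : β x = v.1).symm.trans (hKS w hx').1)
  have hχ : ∀ v, ∃ χ : E n → ℝ, ContDiff ℝ ∞ χ ∧ HasCompactSupport χ ∧ tsupport χ ⊆ U v ∩ A ∧
      (∀ x ∈ K v, χ x = 1) ∧ ∀ x, 0 ≤ χ x ∧ χ x ≤ 1 := fun v =>
    exists_contDiff_one_of_isCompact (hKc v) ((hU v).inter hA)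
      (Set.subset_inter (hKU v) ((hKS v).trans Set.inter_subset_right))
  choose χ hχs hχc hχU hχ1 hχ01 using hχ
  -- Since the cutoffs have disjoint supports, `φ x` is a single value of `β` scaled by a factor in
  -- `[0, 1]`. Star-shapedness of `B` is therefore enough, and convexity is not required.
  have hdisj : ∀ x v w, v ≠ w → χ v x ≠ 0 → χ w x = 0 := by
    intro x v w hvw hv
    by_contra hw
    exact Set.disjoint_left.1 (hUd hvw) (hχU v (subset_tsupport _ hv)).1
      (hχU w (subset_tsupport _ hw)).1
  let φ : E n → V := fun x => ∑ v : β.range, χ v x • v.1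
  have hφ_of : ∀ x v, χ v x ≠ 0 → φ x = χ v x • v.1 := by
    intro x v hv
    refine Finset.sum_eq_single v (fun w _ hw => ?_) (by simp)
    rw [hdisj x v w hw.symm hv, zero_smul]
  have hφ_cases : ∀ x, φ x = 0 ∨ ∃ v, φ x = χ v x • v.1 := by
    intro x
    by_cases h : ∃ v, χ v x ≠ 0
    · exact Or.inr (h.imp fun v hv => hφ_of x v hv)
    · push Not at h
      exact Or.inl (by simp [φ, h])
  have hφR : ∀ x, ‖φ x‖ ≤ R := by
    intro x
    rcases hφ_cases x with h | ⟨v, h⟩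
    · simpa [h] using hR0
    · obtain ⟨y, hy⟩ := SimpleFunc.mem_range.1 v.2
      rw [h, norm_smul, ← hy, Real.norm_eq_abs, abs_of_nonneg (hχ01 v x).1]
      calc _ ≤ 1 * R := mul_le_mul (hχ01 v x).2 (hR y) (norm_nonneg _) zero_le_one
        _ = R := one_mul _
  have hφs : ContDiff ℝ ∞ φ := ContDiff.sum fun v _ => (hχs v).smul contDiff_const
  have hsupp : Function.support φ ⊆ ⋃ v, tsupport (χ v) := by
    intro x hx
    rw [Function.mem_support] at hx
    by_contra hx'
    simp only [Set.mem_iUnion, not_exists] at hx'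
    refine hx (Finset.sum_eq_zero fun v _ => ?_)
    rw [image_eq_zero_of_notMem_tsupport (hx' v), zero_smul]
  have hcomp : IsCompact (⋃ v, tsupport (χ v)) := isCompact_iUnion fun v => hχc v
  have htsupp : tsupport φ ⊆ ⋃ v, tsupport (χ v) := closure_minimal hsupp hcomp.isClosed
  refine ⟨φ, hφs, hcomp.of_isClosed_subset (isClosed_tsupport _) htsupp,
    htsupp.trans (Set.iUnion_subset fun v => (hχU v).trans Set.inter_subset_right), ?_, ?_⟩
  · intro x
    rcases hφ_cases x with h | ⟨v, h⟩
    · simpa [h] using hB0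
    · obtain ⟨y, hy⟩ := SimpleFunc.mem_range.1 v.2
      rw [h, ← hy]
      exact hB _ (hβ y) _ (hχ01 v x).1 (hχ01 v x).2
  · set C : Set (E n) := ⋃ v, K v with hC
    have hCm : MeasurableSet C := (isCompact_iUnion hKc).isClosed.measurableSet
    have hφβ : ∀ x ∈ C, φ x = β x := by
      intro x hx
      obtain ⟨v, hv⟩ := Set.mem_iUnion.1 hx
      rw [hφ_of x v (by simp [hχ1 v x hv]), hχ1 v x hv, one_smul]
      exact ((hKS v hv).1 : β x = v.1).symm
    have hνC : ν Cᶜ ≤ ENNReal.ofReal (N * δ) := by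
      have h0 : ν Aᶜ = 0 := by
        refine withDensity_absolutelyContinuous _ _ ?_
        exact ae_iff.1 hμA
      have hsub : Cᶜ ⊆ Aᶜ ∪ ⋃ v : β.range, ((β ⁻¹' {v.1} ∩ A) \ K v) := by
        intro x hx
        by_cases hxA : x ∈ A
        · refine Or.inr (Set.mem_iUnion.2 ⟨⟨β x, β.mem_range_self x⟩, ⟨rfl, hxA⟩, fun h => ?_⟩)
          exact hx (Set.mem_iUnion.2 ⟨_, h⟩)
        · exact Or.inl hxA
      calc ν Cᶜ ≤ ν Aᶜ + ∑ v : β.range, ν ((β ⁻¹' {v.1} ∩ A) \ K v) :=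
            (measure_mono hsub).trans ((measure_union_le _ _).trans
              (by gcongr; exact measure_iUnion_fintype_le _ _))
        _ ≤ 0 + ∑ v : β.range, ENNReal.ofReal δ := by
            rw [h0]
            gcongr with v
            exact (hKν v).le
        _ = ENNReal.ofReal (N * δ) := by
            rw [ENNReal.ofReal_mul hN0]
            simp [hN]
    have hint : ∀ ψ : E n → V, AEStronglyMeasurable ψ μ → (∀ x, ‖ψ x‖ ≤ R) →
        Integrable (fun x => inner ℝ (ψ x) (H x)) μ := by
      intro ψ hψ hψR
      refine (hH.norm.const_mul R).mono' (hψ.inner hH.1) (Filter.Eventually.of_forall fun x => ?_)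
      exact (norm_inner_le_norm _ _).trans (by gcongr; exact hψR x)
    have hi1 := hint β β.aestronglyMeasurable hR
    have hi2 := hint φ (hφs.continuous.aestronglyMeasurable) hφR
    have hbound : ∫ x, (inner ℝ (β x) (H x) - inner ℝ (φ x) (H x)) ∂μ ≤
        ∫ x in Cᶜ, 2 * R * ‖H x‖ ∂μ := by
      rw [← integral_indicator hCm.compl]
      refine integral_mono (hi1.sub hi2) ((hH.norm.const_mul _).indicator hCm.compl) fun x => ?_
      by_cases hx : x ∈ C
      · simp [hφβ x hx, hx]
      · rw [Set.indicator_of_mem (by exact hx), ← inner_sub_left]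
        refine (real_inner_le_norm _ _).trans ?_
        gcongr
        calc _ ≤ ‖β x‖ + ‖φ x‖ := norm_sub_le _ _
          _ ≤ R + R := add_le_add (hR x) (hφR x)
          _ = 2 * R := by ring
    have hνr : ∫ x in Cᶜ, ‖H x‖ ∂μ ≤ N * δ := by
      rw [integral_norm_eq_lintegral_enorm hH.1.restrict]
      refine ENNReal.toReal_le_of_le_ofReal (by positivity) ?_
      rwa [← withDensity_apply _ hCm.compl]
    rw [integral_sub hi1 hi2, integral_const_mul] at hbound
    have : 2 * R * (N * δ) ≤ ε := by
      have h1 : (2 * R + 1) * (N + 1) * δ = ε := by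
        rw [hδ]; field_simp
      nlinarith [mul_nonneg hR0 hδ0.le, mul_nonneg hN0 hδ0.le]
    have h3 := mul_le_mul_of_nonneg_left hνr (by positivity : 0 ≤ 2 * R)
    linarith

/-- A simple function that maximizes `⟨b k, H⟩` over `k ≤ N`. -/
theorem exists_simpleFunc_forall_inner_le {H : E n → V} (hH : StronglyMeasurable H) (b : ℕ → V)
    (N : ℕ) : ∃ β : SimpleFunc (E n) V, (∀ x, ∃ k, β x = b k) ∧
      ∀ k ≤ N, ∀ x, (inner ℝ (b k) (H x) : ℝ) ≤ inner ℝ (β x) (H x) := by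
  induction N with
  | zero =>
    exact ⟨SimpleFunc.const _ (b 0), fun x => ⟨0, rfl⟩, fun k hk x => by simp [Nat.le_zero.1 hk]⟩
  | succ N ih =>
    obtain ⟨β, hβ, hβ'⟩ := ih
    have hs : MeasurableSet {x | (inner ℝ (β x) (H x) : ℝ) < inner ℝ (b (N + 1)) (H x)} :=
      measurableSet_lt (β.stronglyMeasurable.inner hH).measurable
        (stronglyMeasurable_const.inner hH).measurable
    classical
    refine ⟨SimpleFunc.piecewise _ hs (SimpleFunc.const _ (b (N + 1))) β, fun x => ?_,
      fun k hk x => ?_⟩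
    · by_cases hx : (inner ℝ (β x) (H x) : ℝ) < inner ℝ (b (N + 1)) (H x)
      · exact ⟨N + 1, by simp [hx]⟩
      · simpa [hx] using hβ x
    · by_cases hx : (inner ℝ (β x) (H x) : ℝ) < inner ℝ (b (N + 1)) (H x)
      · rcases Nat.le_succ_iff.1 hk with hk | rfl
        · simpa [hx] using (hβ' k hk x).trans hx.le
        · simp [hx]
      · rcases Nat.le_succ_iff.1 hk with hk | rfl
        · simpa [hx] using hβ' k hk x
        · simpa [hx] using not_lt.1 hx

-- The hard half of the interchange. Monotone convergence reduces the supremum to finitely many `b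
-- k`; the pointwise maximum is then realized by a simple function with values in `B`, which is
-- replaced by a test field at arbitrarily small cost.
open scoped ContDiff in
theorem lintegral_iSup_inner_le_of_forall_contDiff {μ : Measure (E n)} {H : E n → V}
    (hH : Integrable H μ) {A : Set (E n)} (hA : IsOpen A) (hμA : ∀ᵐ x ∂μ, x ∈ A) {B : Set V}
    (hB0 : (0 : V) ∈ B) (hB : ∀ v ∈ B, ∀ t : ℝ, 0 ≤ t → t ≤ 1 → t • v ∈ B)
    (b : ℕ → V) (hb : ∀ k, b k ∈ B) (c : ℝ)
    (hc : ∀ φ : E n → V, ContDiff ℝ ∞ φ → HasCompactSupport φ → tsupport φ ⊆ A →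
      (∀ x, φ x ∈ B) → ∫ x, inner ℝ (φ x) (H x) ∂μ ≤ c) :
    ∫⁻ x, ⨆ k, ENNReal.ofReal (inner ℝ (b k) (H x)) ∂μ ≤ ENNReal.ofReal c := by
  -- Including the value `0` makes the pointwise maximum nonnegative, so that `ENNReal.ofReal`
  -- passes through the integral.
  wlog hb0 : b 0 = 0 generalizing b
  · refine le_trans ?_ (this (fun k => Nat.casesOn k 0 b)
      (fun k => by cases k <;> simp [hB0, hb]) rfl)
    refine lintegral_mono fun x => iSup_le fun k => ?_
    exact le_iSup_of_le (k + 1) le_rfl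
  wlog hHm : StronglyMeasurable H generalizing H
  · have hae := hH.1.ae_eq_mk
    have := this (hH.congr hae) (fun φ h1 h2 h3 h4 => ?_) hH.1.stronglyMeasurable_mk
    · refine le_trans (le_of_eq ?_) this
      refine lintegral_congr_ae ?_
      filter_upwards [hae] with x hx
      rw [hx]
    · refine le_trans (le_of_eq ?_) (hc φ h1 h2 h3 h4)
      refine integral_congr_ae ?_
      filter_upwards [hae] with x hx
      rw [hx]
  have hmeas : ∀ k, Measurable fun x => ENNReal.ofReal (inner ℝ (b k) (H x)) := fun k =>
    (stronglyMeasurable_const.inner hHm).measurable.ennreal_ofReal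
  have hsup : ∀ x, ⨆ k, ENNReal.ofReal (inner ℝ (b k) (H x)) =
      ⨆ N, ⨆ k ∈ Finset.range (N + 1), ENNReal.ofReal (inner ℝ (b k) (H x)) := by
    intro x
    refine le_antisymm (iSup_le fun k => ?_)
      (iSup_le fun N => iSup₂_le fun k _ => le_iSup_of_le k le_rfl)
    exact le_iSup_of_le k (le_iSup₂_of_le k (by simp) le_rfl)
  simp only [hsup]
  rw [lintegral_iSup]
  · refine iSup_le fun N => ?_
    obtain ⟨β, hβ, hβ'⟩ := exists_simpleFunc_forall_inner_le hHm b N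
    have hβB : ∀ x, β x ∈ B := fun x => by
      obtain ⟨k, hk⟩ := hβ x
      exact hk ▸ hb k
    obtain ⟨R, hR⟩ := β.exists_forall_norm_le
    have hi : Integrable (fun x => (inner ℝ (β x) (H x) : ℝ)) μ := by
      refine (hH.norm.const_mul R).mono' (β.aestronglyMeasurable.inner hH.1)
        (Filter.Eventually.of_forall fun x => ?_)
      exact (norm_inner_le_norm _ _).trans (by gcongr; exact hR x)
    have hnn : ∀ x, 0 ≤ (inner ℝ (β x) (H x) : ℝ) := fun x => by
      simpa [hb0] using hβ' 0 (Nat.zero_le _) x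
    calc _ ≤ ∫⁻ x, ENNReal.ofReal (inner ℝ (β x) (H x)) ∂μ := by
          refine lintegral_mono fun x => iSup₂_le fun k hk => ENNReal.ofReal_le_ofReal ?_
          exact hβ' k (by simpa [Nat.lt_succ_iff] using hk) x
      _ = ENNReal.ofReal (∫ x, inner ℝ (β x) (H x) ∂μ) :=
          (ofReal_integral_eq_lintegral_ofReal hi (Filter.Eventually.of_forall hnn)).symm
      _ ≤ ENNReal.ofReal c := by
          refine ENNReal.ofReal_le_ofReal (le_of_forall_pos_le_add fun ε hε => ?_)
          obtain ⟨φ, h1, h2, h3, h4, h5⟩ :=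
            exists_contDiff_integral_inner_ge hH hA hμA hB0 hB β hβB hε
          linarith [hc φ h1 h2 h3 h4]
  · intro N
    exact Measurable.biSup _ (Finset.range (N + 1)).countable_toSet fun k _ => hmeas k
  · intro N N' hNN' x
    refine biSup_mono fun k hk => ?_
    simp only [Finset.mem_range] at hk ⊢
    omega

end SupportFunction


open scoped BoundedContinuousFunction CompactlySupported

/-! ### The positive part of a bounded functional. -/

section PosPart

variable {X : Type*} [TopologicalSpace X]

/-- The value of the positive part of a bounded functional at a nonnegative function. -/
noncomputable def posPartFunctional (G : (X →ᵇ ℝ) →L[ℝ] ℝ) (f : X →ᵇ ℝ) : ℝ :=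
  sSup {y | ∃ g : X →ᵇ ℝ, 0 ≤ g ∧ g ≤ f ∧ G g = y}

variable (G : (X →ᵇ ℝ) →L[ℝ] ℝ) {f h : X →ᵇ ℝ}

theorem boundedContinuous_le_iff : f ≤ h ↔ ∀ x, f x ≤ h x := Iff.rfl

theorem boundedContinuous_nonneg_iff : 0 ≤ f ↔ ∀ x, 0 ≤ f x := Iff.rfl

theorem apply_le_of_le {g : X →ᵇ ℝ} (hg : 0 ≤ g) (hgf : g ≤ f) : G g ≤ ‖G‖ * ‖f‖ := by
  refine (le_abs_self _).trans ((G.le_opNorm g).trans ?_)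
  gcongr
  refine (BoundedContinuousFunction.norm_le (norm_nonneg _)).2 fun x => ?_
  rw [Real.norm_eq_abs, abs_of_nonneg (boundedContinuous_nonneg_iff.1 hg x)]
  exact (boundedContinuous_le_iff.1 hgf x).trans ((le_abs_self _).trans (f.norm_coe_le_norm x))

theorem bddAbove_posPartFunctional :
    BddAbove {y | ∃ g : X →ᵇ ℝ, 0 ≤ g ∧ g ≤ f ∧ G g = y} :=
  ⟨‖G‖ * ‖f‖, by
    rintro y ⟨g, hg, hgf, rfl⟩
    exact apply_le_of_le G hg hgf⟩

theorem le_posPartFunctional {g : X →ᵇ ℝ} (hg : 0 ≤ g) (hgf : g ≤ f) :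
    G g ≤ posPartFunctional G f :=
  le_csSup (bddAbove_posPartFunctional G) ⟨g, hg, hgf, rfl⟩

theorem posPartFunctional_le (hf : 0 ≤ f) {c : ℝ} (hc : ∀ g : X →ᵇ ℝ, 0 ≤ g → g ≤ f → G g ≤ c) :
    posPartFunctional G f ≤ c := by
  refine csSup_le ⟨G 0, 0, le_rfl, hf, rfl⟩ ?_
  rintro y ⟨g, hg, hgf, rfl⟩
  exact hc g hg hgf

theorem posPartFunctional_nonneg (hf : 0 ≤ f) : 0 ≤ posPartFunctional G f := by
  simpa using le_posPartFunctional G le_rfl hf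

theorem posPartFunctional_le_norm (hf : 0 ≤ f) : posPartFunctional G f ≤ ‖G‖ * ‖f‖ :=
  posPartFunctional_le G hf fun _ hg hgf => apply_le_of_le G hg hgf

/-- Riesz decomposition: a function `g` between `0` and `f + h` splits as `g ⊓ f`, which is at most
`f`, plus `g - g ⊓ f`, which is at most `h`. -/
theorem posPartFunctional_add (hf : 0 ≤ f) (hh : 0 ≤ h) :
    posPartFunctional G (f + h) = posPartFunctional G f + posPartFunctional G h := by
  refine le_antisymm (posPartFunctional_le G (add_nonneg hf hh) fun g hg hgfh => ?_) ?_
  · have h1 : 0 ≤ g ⊓ f := le_inf hg hf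
    have h2 : g - g ⊓ f ≤ h := by
      refine boundedContinuous_le_iff.2 fun x => ?_
      have h0 := boundedContinuous_nonneg_iff.1 hh x
      have := boundedContinuous_le_iff.1 hgfh x
      rw [BoundedContinuousFunction.coe_add, Pi.add_apply] at this
      rw [BoundedContinuousFunction.coe_sub, Pi.sub_apply, BoundedContinuousFunction.coe_inf,
        Pi.inf_apply]
      rcases le_total (g x) (f x) with hle | hle
      · rw [inf_eq_left.2 hle]; linarith
      · rw [inf_eq_right.2 hle]; linarith
    have h3 : 0 ≤ g - g ⊓ f := sub_nonneg.2 inf_le_left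
    calc G g = G (g ⊓ f) + G (g - g ⊓ f) := by rw [← map_add, add_sub_cancel]
      _ ≤ _ := add_le_add (le_posPartFunctional G h1 inf_le_right) (le_posPartFunctional G h3 h2)
  · rw [← le_sub_iff_add_le]
    refine posPartFunctional_le G hf fun g hg hgf => ?_
    rw [le_sub_iff_add_le, ← le_sub_iff_add_le']
    refine posPartFunctional_le G hh fun k hk hkh => ?_
    rw [le_sub_iff_add_le', ← map_add]
    exact le_posPartFunctional G (add_nonneg hg hk) (add_le_add hgf hkh)

theorem smul_nonneg_of_nonneg (hf : 0 ≤ f) {c : ℝ} (hc : 0 ≤ c) : 0 ≤ c • f :=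
  boundedContinuous_nonneg_iff.2 fun x => by
    simpa using mul_nonneg hc (boundedContinuous_nonneg_iff.1 hf x)

theorem posPartFunctional_smul_le (hf : 0 ≤ f) {c : ℝ} (hc : 0 < c) :
    posPartFunctional G (c • f) ≤ c * posPartFunctional G f := by
  refine posPartFunctional_le G (smul_nonneg_of_nonneg hf hc.le) fun g hg hgf => ?_
  have h1 : 0 ≤ c⁻¹ • g := smul_nonneg_of_nonneg hg (inv_nonneg.2 hc.le)
  have h2 : c⁻¹ • g ≤ f := boundedContinuous_le_iff.2 fun x => by
    have := boundedContinuous_le_iff.1 hgf x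
    simp only [BoundedContinuousFunction.coe_smul, smul_eq_mul] at this ⊢
    rwa [inv_mul_le_iff₀ hc]
  have := le_posPartFunctional G h1 h2
  rwa [map_smul, smul_eq_mul, inv_mul_le_iff₀ hc] at this

theorem posPartFunctional_smul (hf : 0 ≤ f) {c : ℝ} (hc : 0 ≤ c) :
    posPartFunctional G (c • f) = c * posPartFunctional G f := by
  rcases hc.eq_or_lt with rfl | hc
  · refine le_antisymm ?_ ?_
    · simpa using posPartFunctional_le_norm G (f := 0) le_rfl
    · simpa using posPartFunctional_nonneg G (f := 0) le_rfl
  · refine le_antisymm (posPartFunctional_smul_le G hf hc) ?_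
    have := posPartFunctional_smul_le G (f := c • f) (smul_nonneg_of_nonneg hf hc.le)
      (inv_pos.2 hc)
    rwa [smul_smul, inv_mul_cancel₀ hc.ne', one_smul, le_inv_mul_iff₀ hc] at this

end PosPart

/-! ### Representation of bounded functionals by differences of finite measures. -/

section Riesz

variable {X : Type*} [TopologicalSpace X]

theorem exists_forall_norm_coe_le (f : C_c(X, ℝ≥0)) : ∃ C, ∀ x, ‖(f x : ℝ)‖ ≤ C :=
  (NNReal.continuous_coe.comp f.continuous).bounded_above_of_compact_support
    (f.hasCompactSupport.comp_left (g := ((↑) : ℝ≥0 → ℝ)) rfl)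

/-- A compactly supported continuous function as a bounded real function. -/
noncomputable def toBounded (f : C_c(X, ℝ≥0)) : X →ᵇ ℝ :=
  BoundedContinuousFunction.ofNormedAddCommGroup (fun x => (f x : ℝ))
    (NNReal.continuous_coe.comp f.continuous) (exists_forall_norm_coe_le f).choose
    (exists_forall_norm_coe_le f).choose_spec

@[simp]
theorem toBounded_apply (f : C_c(X, ℝ≥0)) (x : X) : toBounded f x = f x := rfl

theorem toBounded_nonneg (f : C_c(X, ℝ≥0)) : 0 ≤ toBounded f :=
  boundedContinuous_nonneg_iff.2 fun x => (f x).2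

theorem toBounded_add (f g : C_c(X, ℝ≥0)) : toBounded (f + g) = toBounded f + toBounded g := by
  ext x; simp

theorem toBounded_smul (c : ℝ≥0) (f : C_c(X, ℝ≥0)) :
    toBounded (c • f) = (c : ℝ) • toBounded f := by
  ext x; simp

/-- The positive part of a bounded functional, on nonnegative functions of compact support. -/
noncomputable def posPartLinear (G : (X →ᵇ ℝ) →L[ℝ] ℝ) : C_c(X, ℝ≥0) →ₗ[ℝ≥0] ℝ≥0 where
  toFun f := (posPartFunctional G (toBounded f)).toNNReal
  map_add' f g := by
    rw [toBounded_add, posPartFunctional_add G (toBounded_nonneg f) (toBounded_nonneg g),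
      Real.toNNReal_add (posPartFunctional_nonneg G (toBounded_nonneg f))
        (posPartFunctional_nonneg G (toBounded_nonneg g))]
  map_smul' c f := by
    rw [toBounded_smul, posPartFunctional_smul G (toBounded_nonneg f) c.coe_nonneg,
      Real.toNNReal_mul c.coe_nonneg]
    simp

/-- The negative part of a bounded functional, on nonnegative functions of compact support. -/
noncomputable def negPartLinear (G : (X →ᵇ ℝ) →L[ℝ] ℝ) : C_c(X, ℝ≥0) →ₗ[ℝ≥0] ℝ≥0 where
  toFun f := (posPartFunctional G (toBounded f) - G (toBounded f)).toNNReal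
  map_add' f g := by
    rw [toBounded_add, posPartFunctional_add G (toBounded_nonneg f) (toBounded_nonneg g), map_add,
      add_sub_add_comm,
      Real.toNNReal_add (sub_nonneg.2 (le_posPartFunctional G (toBounded_nonneg f) le_rfl))
        (sub_nonneg.2 (le_posPartFunctional G (toBounded_nonneg g) le_rfl))]
  map_smul' c f := by
    rw [toBounded_smul, posPartFunctional_smul G (toBounded_nonneg f) c.coe_nonneg,
      map_smul, smul_eq_mul,
      ← mul_sub, Real.toNNReal_mul c.coe_nonneg]
    simp

theorem posPartLinear_sub_negPartLinear (G : (X →ᵇ ℝ) →L[ℝ] ℝ) (f : C_c(X, ℝ≥0)) :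
    (posPartLinear G f : ℝ) - negPartLinear G f = G (toBounded f) := by
  simp only [posPartLinear, negPartLinear, LinearMap.coe_mk, AddHom.coe_mk]
  rw [Real.coe_toNNReal _ (posPartFunctional_nonneg G (toBounded_nonneg f)),
    Real.coe_toNNReal _ (sub_nonneg.2 (le_posPartFunctional G (toBounded_nonneg f) le_rfl))]
  ring

theorem posPartLinear_le (G : (X →ᵇ ℝ) →L[ℝ] ℝ) (f : C_c(X, ℝ≥0)) :
    posPartLinear G f ≤ ‖G‖ * ‖toBounded f‖ := by
  simp only [posPartLinear, LinearMap.coe_mk, AddHom.coe_mk]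
  rw [Real.coe_toNNReal _ (posPartFunctional_nonneg G (toBounded_nonneg f))]
  exact posPartFunctional_le_norm G (toBounded_nonneg f)

theorem negPartLinear_le (G : (X →ᵇ ℝ) →L[ℝ] ℝ) (f : C_c(X, ℝ≥0)) :
    negPartLinear G f ≤ 2 * ‖G‖ * ‖toBounded f‖ := by
  have h1 := posPartLinear_sub_negPartLinear G f
  have h2 := posPartLinear_le G f
  have h3 := (neg_abs_le _).trans' (neg_le_neg (G.le_opNorm (toBounded f)))
  linarith

variable [T2Space X] [LocallyCompactSpace X] [MeasurableSpace X] [BorelSpace X]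

/-- By inner regularity it suffices to bound the mass of compact sets, and a cutoff of norm at most
`1` that equals `1` on the compact set does this. -/
theorem isFiniteMeasure_rieszMeasure (Λ : C_c(X, ℝ≥0) →ₗ[ℝ≥0] ℝ≥0) (C : ℝ≥0)
    (hC : ∀ f, (Λ f : ℝ) ≤ C * ‖toBounded f‖) : IsFiniteMeasure (NNRealRMK.rieszMeasure Λ) := by
  refine ⟨lt_of_le_of_lt ?_ (ENNReal.coe_lt_top (r := C))⟩
  rw [isOpen_univ.measure_eq_iSup_isCompact]
  refine iSup₂_le fun K _ => iSup_le fun hK => ?_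
  obtain ⟨f, hf1, -, hfc, hf01⟩ :=
    exists_continuous_one_zero_of_isCompact hK isClosed_empty (Set.disjoint_empty K)
  let g : C_c(X, ℝ≥0) := ⟨⟨fun x => (f x).toNNReal, by fun_prop⟩,
    hfc.comp_left (g := Real.toNNReal) (by simp)⟩
  have hg1 : ‖toBounded g‖ ≤ 1 := by
    refine (BoundedContinuousFunction.norm_le zero_le_one).2 fun x => ?_
    simpa [g, abs_of_nonneg (le_max_right (f x) 0)] using (hf01 x).2
  calc NNRealRMK.rieszMeasure Λ K = ∫⁻ x in K, 1 ∂(NNRealRMK.rieszMeasure Λ) := by simp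
    _ ≤ ∫⁻ x in K, g x ∂(NNRealRMK.rieszMeasure Λ) := by
        refine setLIntegral_mono' hK.measurableSet fun x hx => ?_
        simp [g, hf1 hx]
    _ ≤ ∫⁻ x, g x ∂(NNRealRMK.rieszMeasure Λ) := setLIntegral_le_lintegral _ _
    _ = Λ g := NNRealRMK.lintegral_rieszMeasure Λ g
    _ ≤ C := by
        have := (hC g).trans (mul_le_of_le_one_right C.2 hg1)
        exact_mod_cast this

/-- A bounded functional is represented on compactly supported functions by a difference of two
finite measures. -/
theorem exists_measure_sub_of_bounded (G : (X →ᵇ ℝ) →L[ℝ] ℝ) :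
    ∃ μ ν : Measure X, IsFiniteMeasure μ ∧ IsFiniteMeasure ν ∧
      ∀ f : X →ᵇ ℝ, HasCompactSupport f → G f = ∫ x, f x ∂μ - ∫ x, f x ∂ν := by
  have h1 := isFiniteMeasure_rieszMeasure (posPartLinear G) ‖G‖₊ (posPartLinear_le G)
  have h2 := isFiniteMeasure_rieszMeasure (negPartLinear G) (2 * ‖G‖₊)
    (by simpa using negPartLinear_le G)
  refine ⟨_, _, h1, h2, fun f hf => ?_⟩
  let g₁ : C_c(X, ℝ≥0) := ⟨⟨fun x => (f x).toNNReal, by fun_prop⟩,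
    hf.comp_left (g := Real.toNNReal) (by simp)⟩
  let g₂ : C_c(X, ℝ≥0) := ⟨⟨fun x => (-f x).toNNReal, by fun_prop⟩,
    hf.comp_left (g := fun t => Real.toNNReal (-t)) (by simp)⟩
  have hfx : ∀ x, f x = g₁ x - g₂ x := fun x => by
    simp only [g₁, g₂, CompactlySupportedContinuousMap.coe_mk, ContinuousMap.coe_mk]
    exact (max_zero_sub_max_neg_zero_eq_self (f x)).symm
  have hfg : f = toBounded g₁ - toBounded g₂ := by
    ext x
    simpa using hfx x
  have hint : ∀ Λ : C_c(X, ℝ≥0) →ₗ[ℝ≥0] ℝ≥0,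
      ∫ x, f x ∂(NNRealRMK.rieszMeasure Λ) = Λ g₁ - Λ g₂ := by
    intro Λ
    have hi : ∀ g : C_c(X, ℝ≥0), Integrable (fun x => (g x : ℝ)) (NNRealRMK.rieszMeasure Λ) :=
      fun g => Continuous.integrable_of_hasCompactSupport (by fun_prop)
        (g.hasCompactSupport.comp_left (g := ((↑) : ℝ≥0 → ℝ)) rfl)
    simp only [hfx]
    rw [integral_sub (hi _) (hi _), NNRealRMK.integral_rieszMeasure, NNRealRMK.integral_rieszMeasure]
  rw [hint, hint]
  have e1 := posPartLinear_sub_negPartLinear G g₁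
  have e2 := posPartLinear_sub_negPartLinear G g₂
  have e3 : G f = G (toBounded g₁) - G (toBounded g₂) := by rw [← map_sub, ← hfg]
  rw [e3, ← e1, ← e2]
  ring

end Riesz

/-- Test functions as bounded continuous functions. -/
noncomputable def testToBounded {n : ℕ} (Ω : Opens (E n)) : 𝓓(Ω, ℝ) →ₗ[ℝ] (E n →ᵇ ℝ) where
  toFun φ := (φ : E n →ᵇ ℝ)
  map_add' φ ψ := by ext x; simp
  map_smul' c φ := by ext x; simp

/-- A functional on test functions that is bounded for the supremum norm is a difference of two
finite measures. -/
theorem exists_measure_sub_of_forall_le {n : ℕ} {Ω : Opens (E n)} (L : 𝓓(Ω, ℝ) →ₗ[ℝ] ℝ) (C : ℝ)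
    (hL : ∀ (φ : 𝓓(Ω, ℝ)) (c : ℝ), (∀ x, |φ x| ≤ c) → L φ ≤ C * c) :
    ∃ μ ν : Measure (E n), IsFiniteMeasure μ ∧ IsFiniteMeasure ν ∧
      ∀ φ : 𝓓(Ω, ℝ), L φ = ∫ x, φ x ∂μ - ∫ x, φ x ∂ν := by
  have hinj : Function.Injective (testToBounded Ω) := fun φ ψ h => by
    ext x
    exact congrArg (fun f : E n →ᵇ ℝ => f x) h
  let eqv := LinearEquiv.ofInjective (testToBounded Ω) hinj
  have hbound : ∀ f : LinearMap.range (testToBounded Ω),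
      ‖(L ∘ₗ eqv.symm.toLinearMap) f‖ ≤ C * ‖f‖ := by
    intro f
    obtain ⟨φ, rfl⟩ := eqv.surjective f
    have h1 : ∀ x, |φ x| ≤ ‖eqv φ‖ := fun x => (testToBounded Ω φ).norm_coe_le_norm x
    rw [LinearMap.comp_apply, LinearEquiv.coe_coe, LinearEquiv.symm_apply_apply, Real.norm_eq_abs,
      abs_le]
    refine ⟨?_, hL φ _ h1⟩
    have := hL (-φ) ‖eqv φ‖ (by simpa using h1)
    rw [map_neg] at this
    linarith
  -- Hahn-Banach extends the functional to all bounded continuous functions, so no density of test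
  -- functions is needed. The measures represent the extension on compactly supported functions,
  -- hence on test functions.
  obtain ⟨G, hG, -⟩ := exists_extension_norm_eq _
    (LinearMap.mkContinuous (L ∘ₗ eqv.symm.toLinearMap) C hbound)
  obtain ⟨μ, ν, hμ, hν, h⟩ := exists_measure_sub_of_bounded G
  refine ⟨μ, ν, hμ, hν, fun φ => ?_⟩
  have h1 := hG (eqv φ)
  rw [LinearMap.mkContinuous_apply, LinearMap.comp_apply, LinearEquiv.coe_coe,
    LinearEquiv.symm_apply_apply] at h1
  rw [← h1]
  exact h (testToBounded Ω φ) φ.hasCompactSupport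


/-! ### Integration against a vector measure with a density. -/

section WithDensity

variable {X F : Type*} [MeasurableSpace X] [NormedAddCommGroup F] [NormedSpace ℝ F]
  [CompleteSpace F] {μ : Measure X} {H : X → F}

theorem isFiniteMeasure_variation_withDensityᵥ (hH : Integrable H μ) :
    IsFiniteMeasure (μ.withDensityᵥ H).variation := by
  rw [Measure.variation_withDensityᵥ hH]
  exact isFiniteMeasure_withDensity hH.2.ne

theorem integral_simpleFunc_withDensityᵥ (hH : Integrable H μ) (f : SimpleFunc X ℝ) :
    ∫ᵛ x, f x ∂•(μ.withDensityᵥ H) = ∫ x, f x • H x ∂μ := by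
  have := isFiniteMeasure_variation_withDensityᵥ hH
  induction f using SimpleFunc.induction with
  | const c hs =>
    rename_i s
    classical
    simp only [SimpleFunc.coe_piecewise, SimpleFunc.coe_const, SimpleFunc.const_zero,
      SimpleFunc.coe_zero, Set.piecewise_eq_indicator]
    rw [VectorMeasure.integral_indicator hs]
    have h1 : ∀ x, s.indicator (Function.const X c) x • H x = s.indicator (fun x => c • H x) x := by
      intro x
      by_cases hx : x ∈ s <;> simp [hx]
    simp only [h1]
    rw [integral_indicator hs, integral_smul]
    simp only [Function.const_apply]
    rw [VectorMeasure.integral_const, VectorMeasure.restrict_apply _ hs MeasurableSet.univ,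
      Set.univ_inter, withDensityᵥ_apply hH hs]
    simp
  | add hfg hf hg =>
    rename_i f g
    have hi : ∀ f : SimpleFunc X ℝ, (μ.withDensityᵥ H).Integrable f := fun f =>
      SimpleFunc.integrable_of_isFiniteMeasure f
    have hi' : ∀ f : SimpleFunc X ℝ, Integrable (fun x => f x • H x) μ := fun f => by
      obtain ⟨R, hR⟩ := f.exists_forall_norm_le
      exact hH.bdd_smul R f.aestronglyMeasurable (Filter.Eventually.of_forall hR)
    simp only [SimpleFunc.coe_add, Pi.add_apply, add_smul]
    rw [VectorMeasure.integral_fun_add (hi f) (hi g), integral_add (hi' f) (hi' g), hf, hg]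

/-- Bounded simple approximations of `f` reduce this to simple functions. Dominated convergence
applies on both sides, with the constant `C` for the finite variation and with `C * ‖H x‖` for `μ`.
-/
theorem integral_withDensityᵥ (hH : Integrable H μ) {f : X → ℝ} (hf : StronglyMeasurable f)
    {C : ℝ} (hC : ∀ x, ‖f x‖ ≤ C) :
    ∫ᵛ x, f x ∂•(μ.withDensityᵥ H) = ∫ x, f x • H x ∂μ := by
  have := isFiniteMeasure_variation_withDensityᵥ hH
  have hC0 : ∀ x : X, 0 ≤ C := fun x => (norm_nonneg _).trans (hC x)
  have hb : ∀ k x, ‖hf.approxBounded C k x‖ ≤ C := fun k x =>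
    hf.norm_approxBounded_le (hC0 x) k x
  have ht : ∀ x, Filter.Tendsto (fun k => hf.approxBounded C k x) Filter.atTop (nhds (f x)) :=
    fun x => hf.tendsto_approxBounded_of_norm_le (hC x)
  have h1 := VectorMeasure.tendsto_integral_of_dominated_convergence (μ := μ.withDensityᵥ H)
    (B := ContinuousLinearMap.lsmul ℝ ℝ) (fun _ => C)
    (fun k => (hf.approxBounded C k).aestronglyMeasurable) (integrable_const C)
    (fun k => Filter.Eventually.of_forall (hb k)) (Filter.Eventually.of_forall ht)
  have h2 := tendsto_integral_of_dominated_convergence (μ := μ)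
    (F := fun k x => hf.approxBounded C k x • H x) (f := fun x => f x • H x) (fun x => C * ‖H x‖)
    (fun k => (hf.approxBounded C k).aestronglyMeasurable.smul hH.1) (hH.norm.const_mul C)
    (fun k => Filter.Eventually.of_forall fun x => by
      rw [norm_smul]
      gcongr
      exact hb k x)
    (Filter.Eventually.of_forall fun x => (ht x).smul_const _)
  refine tendsto_nhds_unique h1 (h2.congr fun k => ?_)
  exact (integral_simpleFunc_withDensityᵥ hH _).symm

end WithDensity

/-! ### Matrix-valued measures and their polar decomposition. -/

section MatrixMeasure

variable {n : ℕ}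

/-- A matrix as an element of `MatHS n`. -/
def toHS (M : Matrix (Fin n) (Fin n) ℝ) : MatHS n := WithLp.toLp 2 fun ij => M ij.1 ij.2

@[simp]
theorem toHS_apply (M : Matrix (Fin n) (Fin n) ℝ) (ij : Fin n × Fin n) :
    toHS M ij = M ij.1 ij.2 := rfl

theorem integrable_toHS {μ : Measure (E n)} {H : E n → Matrix (Fin n) (Fin n) ℝ}
    (h : ∀ i j, Integrable (fun x => H x i j) μ) : Integrable (fun x => toHS (H x)) μ := by
  refine (PiLp.continuousLinearEquiv 2 ℝ
    fun _ : Fin n × Fin n => ℝ).symm.toContinuousLinearMap.integrable_comp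
    (φ := fun x ij => H x ij.1 ij.2) ?_
  exact Integrable.of_eval fun ij => h ij.1 ij.2

theorem integral_apply {μ : Measure (E n)} {H : E n → MatHS n} (h : Integrable H μ)
    (ij : Fin n × Fin n) : (∫ x, H x ∂μ) ij = ∫ x, H x ij ∂μ :=
  ((EuclideanSpace.proj ij : MatHS n →L[ℝ] ℝ).integral_comp_comm h).symm

theorem integrable_polarDensity (D : VectorMeasure (E n) (MatHS n)) (i j : Fin n) :
    Integrable (fun x => polarDensity D x i j) D.variation :=
  SignedMeasure.integrable_rnDeriv _ _

theorem entry_apply (D : VectorMeasure (E n) (MatHS n)) (i j : Fin n) (s : Set (E n)) :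
    entry D i j s = D s (i, j) := rfl

/-- The polar decomposition of a matrix-valued measure. -/
theorem eq_withDensityᵥ_polarDensity (D : VectorMeasure (E n) (MatHS n))
    [IsFiniteMeasure D.variation] :
    D = D.variation.withDensityᵥ fun x => toHS (polarDensity D x) := by
  have hint := integrable_toHS (integrable_polarDensity D)
  ext s hs ij
  obtain ⟨i, j⟩ := ij
  have hac : entry D i j ≪ᵥ D.variation.toENNRealVectorMeasure := by
    refine VectorMeasure.AbsolutelyContinuous.mk fun t ht h => ?_
    rw [Measure.toENNRealVectorMeasure_apply_measurable ht] at h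
    have : D t = 0 := by
      have := D.enorm_measure_le_variation t
      rw [h] at this
      simpa using this
    rw [entry_apply, this]
    rfl
  rw [withDensityᵥ_apply hint hs, integral_apply hint.integrableOn]
  have h1 := congrArg (fun m : SignedMeasure (E n) => m s)
    (SignedMeasure.withDensityᵥ_rnDeriv_eq (entry D i j) D.variation hac)
  simp only at h1
  rw [withDensityᵥ_apply (SignedMeasure.integrable_rnDeriv _ _) hs] at h1
  exact h1.symm

/-- The integrated form of the fact that the polar density has Hilbert-Schmidt norm `1` almost
everywhere, obtained by taking variations in the polar decomposition. -/
theorem variation_eq_withDensity (D : VectorMeasure (E n) (MatHS n))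
    [IsFiniteMeasure D.variation] :
    D.variation = D.variation.withDensity fun x => ‖toHS (polarDensity D x)‖ₑ := by
  conv_lhs => rw [eq_withDensityᵥ_polarDensity D]
  exact Measure.variation_withDensityᵥ (integrable_toHS (integrable_polarDensity D))

theorem integral_eq_integral_smul_polarDensity (D : VectorMeasure (E n) (MatHS n))
    [IsFiniteMeasure D.variation] {f : E n → ℝ} (hf : StronglyMeasurable f) {C : ℝ}
    (hC : ∀ x, ‖f x‖ ≤ C) :
    ∫ᵛ x, f x ∂•D = ∫ x, f x • toHS (polarDensity D x) ∂D.variation := by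
  refine Eq.trans (congrArg (fun D' => ∫ᵛ x, f x ∂•D') (eq_withDensityᵥ_polarDensity D)) ?_
  exact integral_withDensityᵥ (integrable_toHS (integrable_polarDensity D)) hf hC

theorem integral_smul_toHS_apply {μ : Measure (E n)} {H : E n → Matrix (Fin n) (Fin n) ℝ}
    (hH : ∀ i j, Integrable (fun x => H x i j) μ) {f : E n → ℝ} (hf : StronglyMeasurable f) {C : ℝ}
    (hC : ∀ x, ‖f x‖ ≤ C) (i j : Fin n) :
    (∫ x, f x • toHS (H x) ∂μ) (i, j) = ∫ x, f x * H x i j ∂μ := by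
  rw [integral_apply]
  · rfl
  · exact (integrable_toHS hH).bdd_smul C hf.aestronglyMeasurable (Filter.Eventually.of_forall hC)

theorem integral_testFunction_apply (D : VectorMeasure (E n) (MatHS n))
    [IsFiniteMeasure D.variation] {Ω : Opens (E n)} (φ : 𝓓(Ω, ℝ)) (i j : Fin n) :
    (∫ᵛ x, φ x ∂•D) (i, j) = ∫ x, φ x * polarDensity D x i j ∂D.variation := by
  obtain ⟨C, hC⟩ := φ.continuous.bounded_above_of_compact_support φ.hasCompactSupport
  have h := integral_eq_integral_smul_polarDensity D φ.stronglyMeasurable hC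
  exact (congrArg (fun v : MatHS n => v (i, j)) h).trans
    (integral_smul_toHS_apply (integrable_polarDensity D) φ.stronglyMeasurable hC i j)

/-- A matrix of differences of finite measures defines a matrix-valued measure on `Ω`. -/
theorem exists_vectorMeasure (Ω : Opens (E n)) (μ ν : Fin n → Fin n → Measure (E n))
    (hμ : ∀ i j, IsFiniteMeasure (μ i j)) (hν : ∀ i j, IsFiniteMeasure (ν i j)) :
    ∃ D : VectorMeasure (E n) (MatHS n), IsFiniteMeasure D.variation ∧
      D.variation (Ω : Set (E n))ᶜ = 0 ∧ ∀ (φ : 𝓓(Ω, ℝ)) (i j : Fin n),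
        (∫ᵛ x, φ x ∂•D) (i, j) = ∫ x, φ x ∂(μ i j) - ∫ x, φ x ∂(ν i j) := by
  -- A common finite measure dominating all entries restricted to `Ω`. The matrix measure is `lam`
  -- times the matrix of differences of densities; the restriction to `Ω` is invisible to test
  -- functions on `Ω`.
  let lam : Measure (E n) := (∑ i, ∑ j, (μ i j + ν i j)).restrict Ω
  have hlam : IsFiniteMeasure lam := by
    have : ∀ i, IsFiniteMeasure (∑ j, (μ i j + ν i j)) := fun i => inferInstance
    infer_instance
  have hlam' : SigmaFinite lam := inferInstance
  have hd : ∀ m : Measure (E n), IsFiniteMeasure m →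
      (m.restrict Ω).HaveLebesgueDecomposition lam := fun m hm =>
    Measure.haveLebesgueDecomposition_of_sigmaFinite _ _
  have hle : ∀ i j, μ i j + ν i j ≤ ∑ i, ∑ j, (μ i j + ν i j) := fun i j =>
    (Finset.single_le_sum (f := fun j => μ i j + ν i j) (fun _ _ => Measure.zero_le _)
      (Finset.mem_univ j)).trans
      (Finset.single_le_sum (f := fun i => ∑ j, (μ i j + ν i j)) (fun _ _ => Measure.zero_le _)
        (Finset.mem_univ i))
  have hμac : ∀ i j, (μ i j).restrict Ω ≪ lam := fun i j =>
    (Measure.restrict_mono le_rfl ((Measure.le_add_right le_rfl).trans (hle i j))).absolutelyContinuous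
  have hνac : ∀ i j, (ν i j).restrict Ω ≪ lam := fun i j =>
    (Measure.restrict_mono le_rfl ((Measure.le_add_left le_rfl).trans (hle i j))).absolutelyContinuous
  let H : E n → Matrix (Fin n) (Fin n) ℝ := fun x => Matrix.of fun i j =>
    (((μ i j).restrict Ω).rnDeriv lam x).toReal - (((ν i j).restrict Ω).rnDeriv lam x).toReal
  have hH : ∀ i j, Integrable (fun x => H x i j) lam := fun i j =>
    Measure.integrable_toReal_rnDeriv.sub Measure.integrable_toReal_rnDeriv
  have hint := integrable_toHS hH
  refine ⟨lam.withDensityᵥ fun x => toHS (H x), isFiniteMeasure_variation_withDensityᵥ hint, ?_, ?_⟩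
  · rw [Measure.variation_withDensityᵥ hint]
    refine withDensity_absolutelyContinuous _ _ ?_
    rw [Measure.restrict_apply Ω.isOpen.measurableSet.compl]
    simp
  · intro φ i j
    obtain ⟨C, hC⟩ := φ.continuous.bounded_above_of_compact_support φ.hasCompactSupport
    have hres : ∀ m : Measure (E n), ∫ x, φ x ∂m = ∫ x, φ x ∂(m.restrict Ω) := fun m =>
      (setIntegral_eq_integral_of_forall_compl_eq_zero fun x hx =>
        image_eq_zero_of_notMem_tsupport fun h => hx (φ.tsupport_subset h)).symm
    have h1 := hd _ (hμ i j)
    have h2 := hd _ (hν i j)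
    rw [integral_withDensityᵥ hint φ.stronglyMeasurable hC, integral_apply, hres (μ i j),
      hres (ν i j), ← integral_rnDeriv_smul (hμac i j), ← integral_rnDeriv_smul (hνac i j),
      ← integral_sub]
    · refine integral_congr_ae (Filter.Eventually.of_forall fun x => ?_)
      simp only [PiLp.smul_apply, toHS_apply, smul_eq_mul, H, Matrix.of_apply]
      ring
    · exact Measure.integrable_toReal_rnDeriv.smul_bdd C φ.aestronglyMeasurable
        (Filter.Eventually.of_forall hC)
    · exact Measure.integrable_toReal_rnDeriv.smul_bdd C φ.aestronglyMeasurable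
        (Filter.Eventually.of_forall hC)
    · exact hint.bdd_smul C φ.aestronglyMeasurable (Filter.Eventually.of_forall hC)

end MatrixMeasure


/-! ### Calculus of test functions. -/

section TestFunctions

variable {n : ℕ} {A Ω : Opens (E n)}

theorem lineDerivOp_apply (φ : 𝓓(Ω, ℝ)) (v x : E n) : (∂_{v} φ) x = lineDeriv ℝ φ x v := by
  rw [TestFunction.lineDerivOp_eq_lineDerivCLM (𝕜 := ℝ)]
  exact TestFunction.lineDerivCLM_apply_of_le le_top

theorem lineDerivOp_lineDerivOp_apply (φ : 𝓓(Ω, ℝ)) (v w x : E n) :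
    (∂_{v} (∂_{w} φ)) x = lineDeriv ℝ (fun y => lineDeriv ℝ φ y w) x v := by
  rw [lineDerivOp_apply]
  congr 1
  exact funext fun y => lineDerivOp_apply φ w y

/-- A test function on `A`, seen as a test function on a larger open set. -/
noncomputable def extend (h : A ≤ Ω) (φ : 𝓓(A, ℝ)) : 𝓓(Ω, ℝ) :=
  ⟨φ, φ.contDiff, φ.hasCompactSupport, φ.tsupport_subset.trans h⟩

@[simp]
theorem extend_apply (h : A ≤ Ω) (φ : 𝓓(A, ℝ)) (x : E n) : extend h φ x = φ x := rfl

@[simp]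
theorem lineDerivOp_extend (h : A ≤ Ω) (φ : 𝓓(A, ℝ)) (v x : E n) :
    (∂_{v} (extend h φ)) x = (∂_{v} φ) x := by
  rw [lineDerivOp_apply, lineDerivOp_apply]
  rfl

theorem testFunction_eq_zero {φ : 𝓓(Ω, ℝ)} {x : E n} (hx : x ∉ Ω) : φ x = 0 :=
  image_eq_zero_of_notMem_tsupport fun h => hx (φ.tsupport_subset h)

theorem exists_abs_testFunction_le (φ : 𝓓(Ω, ℝ)) : ∃ C, ∀ x, |φ x| ≤ C :=
  φ.continuous.bounded_above_of_compact_support φ.hasCompactSupport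

theorem integrable_mul_testFunction {f : E n → ℝ} {μ : Measure (E n)}
    (hf : LocallyIntegrableOn f (Ω : Set (E n)) μ) (φ : 𝓓(Ω, ℝ)) :
    Integrable (fun x => f x * φ x) μ := by
  have := φ.integrable_bilin (ContinuousLinearMap.mul ℝ ℝ) hf
  simpa [mul_comm] using this

theorem hasDerivAt_testFunction (φ : 𝓓(Ω, ℝ)) (x v : E n) (t : ℝ) :
    HasDerivAt (fun s : ℝ => φ (x + s • v)) ((∂_{v} φ) (x + t • v)) t := by
  have h1 : DifferentiableAt ℝ φ (x + t • v) :=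
    (φ.contDiff.differentiable (by simp)).differentiableAt
  rw [lineDerivOp_apply, h1.lineDeriv_eq_fderiv]
  have h2 : HasDerivAt (fun s : ℝ => x + s • v) v t := by
    simpa using ((hasDerivAt_id t).smul_const v).const_add x
  exact h1.hasFDerivAt.comp_hasDerivAt t h2

theorem setIntegral_testFunction_mul {A : Opens (E n)} (hA : A ≤ Ω) (f : E n → ℝ) (φ : 𝓓(A, ℝ)) :
    ∫ x in (Ω : Set (E n)), f x * φ x = ∫ x in (A : Set (E n)), f x * φ x := by
  rw [setIntegral_eq_integral_of_forall_compl_eq_zero (s := (A : Set (E n))),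
    setIntegral_eq_integral_of_forall_compl_eq_zero]
  · intro x hx
    rw [testFunction_eq_zero fun h => hx (hA h), mul_zero]
  · intro x hx
    rw [testFunction_eq_zero hx, mul_zero]

end TestFunctions

/-! ### Taylor averages of test functions. -/

section Averages

variable {n : ℕ} {U Ω : Opens (E n)}

/-- The averages of a test function whose second derivatives are the remainders of the first order
Taylor expansions. -/
noncomputable def taylorAverage (φ : E n → ℝ) (v : E n) (h : ℝ) (x : E n) : ℝ :=
  ∫ t in (0 : ℝ)..h, (h - t) * φ (x - t • v)

/-- The average is a convolution of `φ` with a measure carried by the segment from `0` to `h • v`,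
so smoothness is inherited from `φ`. As `v` is a unit vector, the weight `h - t` at `t • v` is the
continuous function `h - ⟪v, y⟫`. -/
theorem contDiff_taylorAverage (φ : 𝓓(U, ℝ)) {v : E n} (hv : ‖v‖ = 1) {h : ℝ} (hh : 0 ≤ h) :
    ContDiff ℝ (⊤ : ℕ∞) (taylorAverage φ v h) := by
  let m : Measure (E n) := (volume.restrict (Set.Ioc (0 : ℝ) h)).map fun t => t • v
  have hm : IsFiniteMeasure m := Measure.isFiniteMeasure_map _ _
  have hc : Continuous fun y : E n => h - inner ℝ v y := by fun_prop
  have h1 := HasCompactSupport.contDiff_convolution_right (ContinuousLinearMap.lsmul ℝ ℝ)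
    (μ := m) φ.hasCompactSupport (hc.locallyIntegrable) φ.contDiff
  convert h1 using 1
  funext x
  rw [convolution_def, integral_map (by fun_prop)
    (Continuous.aestronglyMeasurable (by
      have := φ.continuous
      simp only [ContinuousLinearMap.lsmul_apply, smul_eq_mul]
      fun_prop))]
  rw [taylorAverage, intervalIntegral.integral_of_le hh]
  simp [inner_smul_right, hv, sub_mul]

/-- The quadratic order in `h` is what matters: one power survives the division by `h` in the
difference quotient estimate. -/
theorem abs_taylorAverage_le {φ : E n → ℝ} {c : ℝ} (hφ : ∀ x, |φ x| ≤ c) (v : E n)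
    {h : ℝ} (hh : 0 ≤ h) (x : E n) : |taylorAverage φ v h x| ≤ h ^ 2 * c := by
  have h1 := intervalIntegral.norm_integral_le_of_norm_le_const (a := 0) (b := h) (C := h * c)
    (f := fun t => (h - t) * φ (x - t • v)) fun t ht => by
      rw [Set.uIoc_of_le hh] at ht
      rw [norm_mul, Real.norm_eq_abs, Real.norm_eq_abs, abs_of_nonneg (by linarith [ht.2])]
      exact mul_le_mul (by linarith [ht.1]) (hφ _) (abs_nonneg _) hh
  rw [taylorAverage, ← Real.norm_eq_abs]
  refine h1.trans_eq ?_
  rw [sub_zero, abs_of_nonneg hh]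
  ring

theorem hasDerivAt_taylorAverage (φ : 𝓓(U, ℝ)) (v : E n) (h : ℝ) (x : E n) :
    HasDerivAt (fun s : ℝ => taylorAverage φ v h (x + s • v))
      (taylorAverage (∂_{v} φ : 𝓓(U, ℝ)) v h x) 0 := by
  obtain ⟨C, hC⟩ := exists_abs_testFunction_le (∂_{v} φ)
  have hφ := φ.continuous
  have hφ' := (∂_{v} φ : 𝓓(U, ℝ)).continuous
  have h1 := intervalIntegral.hasDerivAt_integral_of_dominated_loc_of_deriv_le (μ := volume)
    (a := 0) (b := h) (s := Set.univ) (x₀ := (0 : ℝ)) (bound := fun t => |h - t| * C)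
    (F := fun s t => (h - t) * φ (x + s • v - t • v))
    (F' := fun s t => (h - t) * (∂_{v} φ) (x + s • v - t • v)) Filter.univ_mem
    (Filter.Eventually.of_forall fun s => Continuous.aestronglyMeasurable (by fun_prop))
    (Continuous.intervalIntegrable (by fun_prop) _ _)
    (Continuous.aestronglyMeasurable (by fun_prop))
    (Filter.Eventually.of_forall fun t _ s _ => by
      rw [norm_mul, Real.norm_eq_abs]
      gcongr
      exact hC _)
    (Continuous.intervalIntegrable (by fun_prop) _ _)
    (Filter.Eventually.of_forall fun t _ s _ => by
      have := hasDerivAt_testFunction φ (x - t • v) v s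
      rw [show x - t • v + s • v = x + s • v - t • v by abel] at this
      refine HasDerivAt.const_mul _ (this.congr_of_eventuallyEq
        (Filter.Eventually.of_forall fun r => ?_))
      simp only
      congr 1
      abel)
  simpa [taylorAverage] using h1.2

theorem lineDeriv_taylorAverage (φ : 𝓓(U, ℝ)) (v : E n) (h : ℝ) (x : E n) :
    lineDeriv ℝ (taylorAverage φ v h) x v = taylorAverage (∂_{v} φ : 𝓓(U, ℝ)) v h x :=
  (hasDerivAt_taylorAverage φ v h x).deriv

/-- Taylor's formula with integral remainder, along the segment from `x` to `x - h • v`. -/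
theorem taylorAverage_lineDerivOp_lineDerivOp (φ : 𝓓(U, ℝ)) (v : E n) (h : ℝ) (x : E n) :
    taylorAverage (∂_{v} (∂_{v} φ) : 𝓓(U, ℝ)) v h x = φ (x - h • v) + h * (∂_{v} φ) x - φ x := by
  have hd : ∀ (ψ : 𝓓(U, ℝ)) (t : ℝ),
      HasDerivAt (fun t : ℝ => ψ (x - t • v)) (-(∂_{v} ψ) (x - t • v)) t := fun ψ t => by
    have h1 := (hasDerivAt_testFunction ψ x v (-t)).comp t (hasDerivAt_neg t)
    simpa [Function.comp_def, sub_eq_add_neg] using h1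
  -- An antiderivative of the integrand: on differentiation the two first order terms cancel.
  have h2 : ∀ t ∈ Set.uIcc 0 h, HasDerivAt
      (fun t : ℝ => φ (x - t • v) - (h - t) * (∂_{v} φ) (x - t • v))
      ((h - t) * (∂_{v} (∂_{v} φ)) (x - t • v)) t := fun t _ => by
    have h3 := (hd φ t).sub (((hasDerivAt_id t).const_sub h).mul (hd (∂_{v} φ) t))
    refine h3.congr_deriv ?_
    simp only [id]
    ring
  have hφ := (∂_{v} (∂_{v} φ) : 𝓓(U, ℝ)).continuous
  rw [taylorAverage, intervalIntegral.integral_eq_sub_of_hasDerivAt h2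
    (Continuous.intervalIntegrable (by fun_prop) _ _)]
  simp
  ring

/-- The Taylor average of a test function is a test function. -/
theorem exists_testFunction_taylorAverage (φ : 𝓓(U, ℝ)) {v : E n} (hv : ‖v‖ = 1) {h : ℝ}
    (hh : 0 ≤ h) (hU : ∀ y ∈ U, ∀ t, 0 ≤ t → t ≤ h → y + t • v ∈ Ω) :
    ∃ ψ : 𝓓(Ω, ℝ), ∀ x, ψ x = taylorAverage φ v h x := by
  have hK : IsCompact ((fun p : E n × ℝ => p.1 + p.2 • v) '' (tsupport φ ×ˢ Set.Icc 0 h)) :=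
    (φ.hasCompactSupport.isCompact.prod isCompact_Icc).image (by fun_prop)
  set K := (fun p : E n × ℝ => p.1 + p.2 • v) '' (tsupport φ ×ˢ Set.Icc 0 h) with hKdef
  have hsupp : tsupport (taylorAverage φ v h) ⊆ K := by
    refine closure_minimal (fun x hx => ?_) hK.isClosed
    by_contra hxK
    refine hx ?_
    rw [taylorAverage]
    refine intervalIntegral.integral_zero_ae (Filter.Eventually.of_forall fun t ht => ?_)
    rw [Set.uIoc_of_le hh] at ht
    rw [image_eq_zero_of_notMem_tsupport (f := φ), mul_zero]
    intro hmem
    exact hxK ⟨(x - t • v, t), ⟨hmem, ht.1.le, ht.2⟩, by simp⟩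
  have hKΩ : K ⊆ Ω := by
    rintro _ ⟨⟨y, t⟩, ⟨hy, ht⟩, rfl⟩
    exact hU y (φ.tsupport_subset hy) t ht.1 ht.2
  exact ⟨⟨taylorAverage φ v h, contDiff_taylorAverage φ hv hh,
    hK.of_isClosed_subset (isClosed_tsupport _) hsupp, hsupp.trans hKΩ⟩, fun x => rfl⟩

end Averages

/-! ### Difference quotients are Cauchy in `L¹`. -/

section DifferenceQuotients

variable {n : ℕ} {U Ω : Opens (E n)}

/-- The difference quotients of `f` in the direction `v`. -/
noncomputable def diffQuot (f : E n → ℝ) (v : E n) (h : ℝ) (x : E n) : ℝ :=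
  h⁻¹ * (f (x + h • v) - f x)

theorem exists_testFunction_shift (φ : 𝓓(U, ℝ)) (w : E n) (hU : ∀ y ∈ U, y + w ∈ Ω) :
    ∃ ψ : 𝓓(Ω, ℝ), ∀ x, ψ x = φ (x - w) := by
  have h1 : (fun x => φ (x - w)) = φ ∘ (Homeomorph.subRight w) := rfl
  refine ⟨⟨fun x => φ (x - w), φ.contDiff.comp (contDiff_id.sub contDiff_const), ?_, ?_⟩,
    fun x => rfl⟩
  · rw [h1]
    exact φ.hasCompactSupport.comp_homeomorph _
  · rw [h1, tsupport_comp_eq_preimage]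
    intro x hx
    have := hU _ (φ.tsupport_subset hx)
    simpa using this

variable {f : E n → ℝ} {v : E n} {V : ℝ}

/-- The central estimate. Applying `hV` to the Taylor average `ψ` of `φ`, and moving the translation
from `φ` to `f`, yields `h` times the left side, against a bound `V * (h ^ 2 * c)`. Thus the
difference quotient approximates the distributional `∂_v f` with error at most `V * h` in the dual
of the supremum norm. -/
theorem integral_add_integral_diffQuot_le (hf : LocallyIntegrableOn f (Ω : Set (E n)) volume)
    (hv : ‖v‖ = 1)
    (hV : ∀ (ψ : 𝓓(Ω, ℝ)) (c : ℝ), (∀ x, |ψ x| ≤ c) →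
      ∫ x in (Ω : Set (E n)), f x * (∂_{v} (∂_{v} ψ)) x ≤ V * c)
    {h : ℝ} (hh : 0 < h) (hU : ∀ y ∈ U, ∀ t, 0 ≤ t → t ≤ h → y + t • v ∈ Ω)
    (φ : 𝓓(U, ℝ)) {c : ℝ} (hφ : ∀ x, |φ x| ≤ c) :
    (∫ x in (Ω : Set (E n)), f x * (∂_{v} φ) x) + ∫ x in (U : Set (E n)), diffQuot f v h x * φ x
      ≤ V * h * c := by
  have hUΩ : U ≤ Ω := fun y hy => by simpa using hU y hy 0 le_rfl hh.le
  obtain ⟨ψ, hψ⟩ := exists_testFunction_taylorAverage φ hv hh.le hU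
  obtain ⟨σ, hσ⟩ := exists_testFunction_shift φ (h • v) fun y hy => hU y hy h hh.le le_rfl
  have hψ2 : ∀ x, (∂_{v} (∂_{v} ψ)) x = σ x + h * (∂_{v} φ) x - φ x := fun x => by
    rw [lineDerivOp_lineDerivOp_apply, show (ψ : E n → ℝ) = taylorAverage φ v h from funext hψ]
    simp_rw [lineDeriv_taylorAverage]
    rw [taylorAverage_lineDerivOp_lineDerivOp, hσ]
  have h1 := hV ψ (h ^ 2 * c) fun x => by
    rw [hψ]
    exact abs_taylorAverage_le hφ v hh.le x
  have iσ := (integrable_mul_testFunction hf σ).restrict (s := (Ω : Set (E n)))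
  have iφ : Integrable (fun x => f x * φ x) (volume.restrict (Ω : Set (E n))) :=
    (integrable_mul_testFunction hf (extend hUΩ φ)).restrict
  have i1 : Integrable (fun x => f x * (∂_{v} φ) x) (volume.restrict (Ω : Set (E n))) :=
    (integrable_mul_testFunction hf (extend hUΩ (∂_{v} φ))).restrict
  have h2 : ∫ x in (Ω : Set (E n)), f x * (∂_{v} (∂_{v} ψ)) x =
      (∫ x in (Ω : Set (E n)), f x * σ x) + h * (∫ x in (Ω : Set (E n)), f x * (∂_{v} φ) x) -
        ∫ x in (Ω : Set (E n)), f x * φ x := by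
    rw [← integral_const_mul, ← integral_add iσ (i1.const_mul h),
      ← integral_sub (f := fun x => f x * σ x + h * (f x * (∂_{v} φ : 𝓓(U, ℝ)) x))
        (iσ.add (i1.const_mul h)) iφ]
    refine integral_congr_ae (Filter.Eventually.of_forall fun x => ?_)
    simp only [hψ2]
    ring
  have h3 : ∫ x in (Ω : Set (E n)), f x * σ x = ∫ x, f (x + h • v) * φ x := by
    rw [setIntegral_eq_integral_of_forall_compl_eq_zero fun x hx => by
      rw [testFunction_eq_zero hx, mul_zero],
      ← integral_add_right_eq_self (fun x => f x * σ x) (h • v)]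
    simp [hσ]
  have i2 : Integrable (fun x => f (x + h • v) * φ x) volume := by
    have := (integrable_mul_testFunction hf σ).comp_add_right (h • v)
    simpa [hσ] using this
  have i3 : Integrable (fun x => f x * φ x) volume :=
    integrable_mul_testFunction hf (extend hUΩ φ)
  have h4 : ∫ x in (U : Set (E n)), diffQuot f v h x * φ x =
      h⁻¹ * ((∫ x in (Ω : Set (E n)), f x * σ x) - ∫ x in (Ω : Set (E n)), f x * φ x) := by
    rw [h3, setIntegral_testFunction_mul hUΩ, setIntegral_eq_integral_of_forall_compl_eq_zero
      (fun x hx => by rw [testFunction_eq_zero hx, mul_zero]),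
      setIntegral_eq_integral_of_forall_compl_eq_zero
      (fun x hx => by rw [testFunction_eq_zero hx, mul_zero]), ← integral_sub i2 i3,
      ← integral_const_mul]
    refine integral_congr_ae (Filter.Eventually.of_forall fun x => ?_)
    simp only [diffQuot]
    ring
  rw [h2] at h1
  rw [h4]
  have h5 := mul_le_mul_of_nonneg_left h1 (inv_nonneg.2 hh.le)
  calc _ = h⁻¹ * ((∫ x in (Ω : Set (E n)), f x * σ x) +
        h * (∫ x in (Ω : Set (E n)), f x * (∂_{v} φ) x) - ∫ x in (Ω : Set (E n)), f x * φ x) := by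
        field_simp
        ring
    _ ≤ h⁻¹ * (V * (h ^ 2 * c)) := h5
    _ = V * h * c := by
        field_simp

theorem integrableOn_diffQuot (hf : LocallyIntegrableOn f (Ω : Set (E n)) volume)
    (hc : IsCompact (closure (U : Set (E n)))) {h : ℝ}
    (hU : ∀ y ∈ closure (U : Set (E n)), y ∈ Ω ∧ y + h • v ∈ Ω) :
    IntegrableOn (diffQuot f v h) (U : Set (E n)) volume := by
  have h1 : IntegrableOn f (closure (U : Set (E n))) volume :=
    hf.integrableOn_compact_subset (fun y hy => (hU y hy).1) hc
  have h2 : IntegrableOn f ((fun y => y + h • v) '' closure (U : Set (E n))) volume := by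
    refine hf.integrableOn_compact_subset ?_ (hc.image (by fun_prop))
    rintro _ ⟨y, hy, rfl⟩
    exact (hU y hy).2
  have h3 : IntegrableOn (fun y => f (y + h • v)) (closure (U : Set (E n))) volume :=
    ((measurePreserving_add_right volume (h • v)).integrableOn_image
      (measurableEmbedding_addRight _)).1 h2
  exact IntegrableOn.mono_set ((h3.sub h1).const_mul h⁻¹) subset_closure

/-- Adding the central estimate for `h` and `φ` to the one for `k` and `-φ` cancels the term with
`∂_v φ`. Duality between `L¹` and test functions bounded by `1` then bounds the `L¹` norm. -/
theorem lintegral_diffQuot_sub_le (hf : LocallyIntegrableOn f (Ω : Set (E n)) volume)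
    (hv : ‖v‖ = 1)
    (hV : ∀ (ψ : 𝓓(Ω, ℝ)) (c : ℝ), (∀ x, |ψ x| ≤ c) →
      ∫ x in (Ω : Set (E n)), f x * (∂_{v} (∂_{v} ψ)) x ≤ V * c)
    (hc : IsCompact (closure (U : Set (E n)))) {δ : ℝ}
    (hU : ∀ y ∈ closure (U : Set (E n)), ∀ t, 0 ≤ t → t ≤ δ → y + t • v ∈ Ω)
    {h k : ℝ} (hh : 0 < h) (hhδ : h ≤ δ) (hk : 0 < k) (hkδ : k ≤ δ) :
    ∫⁻ x in (U : Set (E n)), ‖diffQuot f v h x - diffQuot f v k x‖ₑ ≤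
      ENNReal.ofReal (V * h + V * k) := by
  have hδ : 0 ≤ δ := hh.le.trans hhδ
  have ih : IntegrableOn (diffQuot f v h) (U : Set (E n)) volume :=
    integrableOn_diffQuot hf hc fun y hy => ⟨by simpa using hU y hy 0 le_rfl hδ, hU y hy h hh.le hhδ⟩
  have ik : IntegrableOn (diffQuot f v k) (U : Set (E n)) volume :=
    integrableOn_diffQuot hf hc fun y hy => ⟨by simpa using hU y hy 0 le_rfl hδ, hU y hy k hk.le hkδ⟩
  -- The scalar case with `B = [-1, 1]`: the values `1` and `-1` suffice, since their pairings with
  -- a real number have its absolute value as maximum.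
  have key := lintegral_iSup_inner_le_of_forall_contDiff (V := ℝ)
    (μ := volume.restrict (U : Set (E n))) (H := fun x => diffQuot f v h x - diffQuot f v k x)
    (ih.sub ik) U.isOpen (ae_restrict_mem U.isOpen.measurableSet) (B := {r | |r| ≤ 1})
    (by simp) (fun r hr t ht0 ht1 => by
      simp only [Set.mem_ofPred_eq, smul_eq_mul, abs_mul, abs_of_nonneg ht0] at hr ⊢
      nlinarith [abs_nonneg r])
    (fun j => if j = 0 then 1 else -1) (fun j => by
      simp only [Set.mem_ofPred_eq]
      split_ifs <;> simp) (V * h + V * k) ?_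
  · refine le_trans (lintegral_mono fun x => ?_) key
    rw [← ofReal_norm, Real.norm_eq_abs]
    rcases le_total 0 (diffQuot f v h x - diffQuot f v k x) with hx | hx
    · refine le_iSup_of_le 0 (ENNReal.ofReal_le_ofReal ?_)
      simp [abs_of_nonneg hx]
    · refine le_iSup_of_le 1 (ENNReal.ofReal_le_ofReal ?_)
      simp [abs_of_nonpos hx]
  · intro φ hφ1 hφ2 hφ3 hφ4
    let ψ : 𝓓(U, ℝ) := ⟨φ, hφ1, hφ2, hφ3⟩
    have hψ : ∀ x, |ψ x| ≤ 1 := hφ4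
    have h1 := integral_add_integral_diffQuot_le (U := U) hf hv hV hh
      (fun y hy t h0 h1 => hU y (subset_closure hy) t h0 (h1.trans hhδ)) ψ hψ
    have h2 := integral_add_integral_diffQuot_le (U := U) hf hv hV hk
      (fun y hy t h0 h1 => hU y (subset_closure hy) t h0 (h1.trans hkδ)) (-ψ) (c := 1)
      (fun x => by simpa using hψ x)
    have ihψ : Integrable (fun x => diffQuot f v h x * ψ x) (volume.restrict (U : Set (E n))) :=
      Integrable.mul_bdd ih ψ.aestronglyMeasurable (Filter.Eventually.of_forall hψ)
    have ikψ : Integrable (fun x => diffQuot f v k x * ψ x) (volume.restrict (U : Set (E n))) :=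
      Integrable.mul_bdd ik ψ.aestronglyMeasurable (Filter.Eventually.of_forall hψ)
    have h3 : ∀ x, (∂_{v} (-ψ)) x = - (∂_{v} ψ) x := fun x => by
      rw [show (∂_{v} (-ψ) : 𝓓(U, ℝ)) = -(∂_{v} ψ : 𝓓(U, ℝ)) from
        LineDeriv.lineDerivOp_neg v ψ]
      rfl
    have h4 : ∀ x, (-ψ) x = -ψ x := fun x => rfl
    simp only [h3, h4, mul_neg, integral_neg] at h2
    calc _ = (∫ x in (U : Set (E n)), diffQuot f v h x * ψ x) -
          ∫ x in (U : Set (E n)), diffQuot f v k x * ψ x := by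
          rw [← integral_sub ihψ ikψ]
          refine integral_congr_ae (Filter.Eventually.of_forall fun x => ?_)
          change (diffQuot f v h x - diffQuot f v k x) * ψ x = _
          ring
      _ ≤ V * h + V * k := by linarith

end DifferenceQuotients


/-! ### The weak derivative as a limit of dyadic difference quotients. -/

section WeakDerivative

variable {n : ℕ} {Ω : Opens (E n)} {f : E n → ℝ} {v : E n} {V : ℝ}

/-- The limit of the dyadic difference quotients. -/
noncomputable def dyadicDeriv (f : E n → ℝ) (v x : E n) : ℝ :=
  Filter.limUnder Filter.atTop fun k : ℕ => diffQuot f v ((1 / 2) ^ k) x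

theorem exists_opens_of_isCompact {K : Set (E n)} (hK : IsCompact K) (hKΩ : K ⊆ Ω) :
    ∃ U : Opens (E n), K ⊆ U ∧ IsCompact (closure (U : Set (E n))) ∧
      closure (U : Set (E n)) ⊆ Ω := by
  obtain ⟨L, hL, hKL, hLΩ⟩ := exists_compact_between hK Ω.isOpen hKΩ
  have h : closure (interior L) ⊆ L := closure_minimal interior_subset hL.isClosed
  exact ⟨⟨interior L, isOpen_interior⟩, hKL, hL.of_isClosed_subset isClosed_closure h, h.trans hLΩ⟩

theorem exists_forall_add_smul_mem {U : Opens (E n)} (hv : ‖v‖ = 1)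
    (hc : IsCompact (closure (U : Set (E n)))) (hU : closure (U : Set (E n)) ⊆ Ω) :
    ∃ δ : ℝ, 0 < δ ∧ ∀ y ∈ closure (U : Set (E n)), ∀ t, 0 ≤ t → t ≤ δ → y + t • v ∈ Ω := by
  obtain ⟨δ, hδ, h⟩ := hc.exists_cthickening_subset_open Ω.isOpen hU
  refine ⟨δ, hδ, fun y hy t h0 h1 => h ?_⟩
  refine Metric.mem_cthickening_of_dist_le _ y _ _ hy ?_
  simpa [dist_eq_norm, norm_smul, hv, abs_of_nonneg h0] using h1

/-- Dyadic steps give a summable Cauchy rate in `L¹`, hence convergence almost everywhere along the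
full dyadic sequence. The limit is `dyadicDeriv`, which is defined without reference to `U`, so no
gluing over different `U` is needed. The shift by `k₀` keeps translates of the closure of `U` inside
`Ω`. -/
theorem tendsto_eLpNorm_diffQuot (hf : LocallyIntegrableOn f (Ω : Set (E n)) volume)
    (hv : ‖v‖ = 1) (hV0 : 0 ≤ V)
    (hV : ∀ (ψ : 𝓓(Ω, ℝ)) (c : ℝ), (∀ x, |ψ x| ≤ c) →
      ∫ x in (Ω : Set (E n)), f x * (∂_{v} (∂_{v} ψ)) x ≤ V * c) {U : Opens (E n)}
    (hc : IsCompact (closure (U : Set (E n)))) {k₀ : ℕ}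
    (hk : ∀ y ∈ closure (U : Set (E n)), ∀ t, 0 ≤ t → t ≤ (1 / 2 : ℝ) ^ k₀ → y + t • v ∈ Ω) :
    AEStronglyMeasurable (dyadicDeriv f v) (volume.restrict (U : Set (E n))) ∧
    Filter.Tendsto (fun k => eLpNorm (diffQuot f v ((1 / 2) ^ (k + k₀)) - dyadicDeriv f v) 1
      (volume.restrict (U : Set (E n)))) Filter.atTop (nhds 0) := by
  have hle : ∀ k, (1 / 2 : ℝ) ^ (k + k₀) ≤ (1 / 2) ^ k₀ := fun k =>
    pow_le_pow_of_le_one (by norm_num) (by norm_num) (Nat.le_add_left _ _)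
  have hmeas : ∀ k, AEStronglyMeasurable (diffQuot f v ((1 / 2) ^ (k + k₀)))
      (volume.restrict (U : Set (E n))) := fun k =>
    (integrableOn_diffQuot hf hc fun y hy =>
      ⟨by simpa using hk y hy 0 le_rfl (by positivity),
        hk y hy _ (by positivity) (hle k)⟩).aestronglyMeasurable
  -- The distance is at most `2 * V` times the dyadic power; the extra `1` makes the inequality
  -- strict even for `V = 0`.
  let B : ℕ → ℝ≥0∞ := fun N => ENNReal.ofReal ((2 * V + 1) * (1 / 2) ^ N)
  have hB : ∑' i, B i ≠ ∞ :=
    (summable_geometric_two.mul_left (2 * V + 1)).tsum_ofReal_ne_top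
  have hcau : ∀ N j k : ℕ, N ≤ j → N ≤ k →
      eLpNorm (diffQuot f v ((1 / 2) ^ (j + k₀)) - diffQuot f v ((1 / 2) ^ (k + k₀))) 1
        (volume.restrict (U : Set (E n))) < B N := fun N j k hj hk' => by
    rw [eLpNorm_one_eq_lintegral_enorm]
    refine (lintegral_diffQuot_sub_le hf hv hV hc hk (by positivity) (hle j) (by positivity)
      (hle k)).trans_lt ?_
    refine (ENNReal.ofReal_lt_ofReal_iff (by positivity)).2 ?_
    have hj' : (1 / 2 : ℝ) ^ (j + k₀) ≤ (1 / 2) ^ N :=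
      pow_le_pow_of_le_one (by norm_num) (by norm_num) (by omega)
    have hk'' : (1 / 2 : ℝ) ^ (k + k₀) ≤ (1 / 2) ^ N :=
      pow_le_pow_of_le_one (by norm_num) (by norm_num) (by omega)
    have h0 : (0 : ℝ) < (1 / 2) ^ N := by positivity
    nlinarith [mul_le_mul_of_nonneg_left hj' hV0, mul_le_mul_of_nonneg_left hk'' hV0]
  have hlim : ∀ᵐ x ∂volume.restrict (U : Set (E n)), Filter.Tendsto
      (fun k => diffQuot f v ((1 / 2) ^ (k + k₀)) x) Filter.atTop (nhds (dyadicDeriv f v x)) := by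
    filter_upwards [Lp.ae_tendsto_of_cauchy_eLpNorm hmeas le_rfl hB hcau] with x ⟨l, hl⟩
    have hl' : Filter.Tendsto (fun k : ℕ => diffQuot f v ((1 / 2) ^ k) x) Filter.atTop (nhds l) :=
      (Filter.tendsto_add_atTop_iff_nat k₀).1 hl
    rw [dyadicDeriv, hl'.limUnder_eq]
    exact hl
  exact ⟨aestronglyMeasurable_of_tendsto_ae _ hmeas hlim,
    Lp.cauchy_tendsto_of_tendsto hmeas _ hB hcau hlim⟩

theorem integrableOn_dyadicDeriv_and_integral_eq
    (hf : LocallyIntegrableOn f (Ω : Set (E n)) volume)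
    (hv : ‖v‖ = 1) (hV0 : 0 ≤ V)
    (hV : ∀ (ψ : 𝓓(Ω, ℝ)) (c : ℝ), (∀ x, |ψ x| ≤ c) →
      ∫ x in (Ω : Set (E n)), f x * (∂_{v} (∂_{v} ψ)) x ≤ V * c) {U : Opens (E n)}
    (hc : IsCompact (closure (U : Set (E n)))) (hU : closure (U : Set (E n)) ⊆ Ω) :
    IntegrableOn (dyadicDeriv f v) (U : Set (E n)) volume ∧ ∀ φ : 𝓓(U, ℝ),
      ∫ x in (Ω : Set (E n)), f x * (∂_{v} φ) x =
        -∫ x in (U : Set (E n)), dyadicDeriv f v x * φ x := by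
  obtain ⟨δ, hδ, hδU⟩ := exists_forall_add_smul_mem hv hc hU
  obtain ⟨k₀, hk₀⟩ := exists_pow_lt_of_lt_one hδ (by norm_num : (1 / 2 : ℝ) < 1)
  have hk : ∀ y ∈ closure (U : Set (E n)), ∀ t, 0 ≤ t → t ≤ (1 / 2 : ℝ) ^ k₀ → y + t • v ∈ Ω :=
    fun y hy t h0 h1 => hδU y hy t h0 (h1.trans hk₀.le)
  obtain ⟨hmeas, hlim⟩ := tendsto_eLpNorm_diffQuot hf hv hV0 hV hc hk
  have hle : ∀ k, (1 / 2 : ℝ) ^ (k + k₀) ≤ (1 / 2) ^ k₀ := fun k =>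
    pow_le_pow_of_le_one (by norm_num) (by norm_num) (Nat.le_add_left _ _)
  have hint : ∀ k, Integrable (diffQuot f v ((1 / 2) ^ (k + k₀)))
      (volume.restrict (U : Set (E n))) := fun k =>
    integrableOn_diffQuot hf hc fun y hy =>
      ⟨by simpa using hk y hy 0 le_rfl (by positivity), hk y hy _ (by positivity) (hle k)⟩
  have hg : Integrable (dyadicDeriv f v) (volume.restrict (U : Set (E n))) := by
    obtain ⟨k, hk1⟩ := (hlim.eventually (gt_mem_nhds (zero_lt_one (α := ℝ≥0∞)))).exists
    have h1 : Integrable (diffQuot f v ((1 / 2) ^ (k + k₀)) - dyadicDeriv f v)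
        (volume.restrict (U : Set (E n))) :=
      memLp_one_iff_integrable.1 ⟨(hint k).1.sub hmeas, hk1.trans ENNReal.one_lt_top⟩
    simpa using (hint k).sub h1
  refine ⟨hg, fun φ => ?_⟩
  obtain ⟨c, hφ⟩ := exists_abs_testFunction_le φ
  -- The central estimate for `φ` and for `-φ` bounds the absolute value by a quantity that tends to
  -- `0`.
  have hd : ∀ k, |(∫ x in (Ω : Set (E n)), f x * (∂_{v} φ) x) +
      ∫ x in (U : Set (E n)), diffQuot f v ((1 / 2) ^ (k + k₀)) x * φ x| ≤
        V * (1 / 2) ^ (k + k₀) * c := fun k => by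
    have hUk : ∀ y ∈ U, ∀ t, 0 ≤ t → t ≤ (1 / 2 : ℝ) ^ (k + k₀) → y + t • v ∈ Ω :=
      fun y hy t h0 h1 => hk y (subset_closure hy) t h0 (h1.trans (hle k))
    refine abs_le'.2 ⟨integral_add_integral_diffQuot_le hf hv hV (by positivity) hUk φ hφ, ?_⟩
    have h2 := integral_add_integral_diffQuot_le hf hv hV (h := (1 / 2) ^ (k + k₀))
      (by positivity) hUk (-φ) (c := c) (fun x => by simpa using hφ x)
    have h3 : ∀ x, (∂_{v} (-φ)) x = - (∂_{v} φ) x := fun x => by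
      rw [show (∂_{v} (-φ) : 𝓓(U, ℝ)) = -(∂_{v} φ : 𝓓(U, ℝ)) from LineDeriv.lineDerivOp_neg v φ]
      rfl
    have h4 : ∀ x, (-φ) x = -φ x := fun x => rfl
    simp only [h3, h4, mul_neg, integral_neg] at h2
    linarith
  have hpow : Filter.Tendsto (fun k : ℕ => V * (1 / 2 : ℝ) ^ (k + k₀) * c) Filter.atTop
      (nhds 0) := by
    have := (tendsto_pow_atTop_nhds_zero_of_lt_one (r := (1 / 2 : ℝ)) (by norm_num)
      (by norm_num)).comp (Filter.tendsto_add_atTop_nat k₀)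
    simpa using (this.const_mul V).mul_const c
  have h1 : Filter.Tendsto (fun k => (∫ x in (Ω : Set (E n)), f x * (∂_{v} φ) x) +
      ∫ x in (U : Set (E n)), diffQuot f v ((1 / 2) ^ (k + k₀)) x * φ x) Filter.atTop (nhds 0) :=
    squeeze_zero_norm hd hpow
  have h2 : Filter.Tendsto (fun k => ∫ x in (U : Set (E n)),
      diffQuot f v ((1 / 2) ^ (k + k₀)) x * φ x) Filter.atTop
      (nhds (∫ x in (U : Set (E n)), dyadicDeriv f v x * φ x)) := by
    have hb : ∀ᵐ x ∂(volume.restrict (U : Set (E n))), ‖φ x‖ ≤ c :=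
      Filter.Eventually.of_forall hφ
    have hi : ∀ k, Integrable (fun x => diffQuot f v ((1 / 2) ^ (k + k₀)) x * φ x)
      (volume.restrict (U : Set (E n))) := fun k => (hint k).mul_bdd φ.aestronglyMeasurable hb
    refine tendsto_integral_of_L1 _ (hg.mul_bdd φ.aestronglyMeasurable hb).1
      (Filter.Eventually.of_forall hi) ?_
    have h3 : Filter.Tendsto (fun k => ENNReal.ofReal c *
        eLpNorm (diffQuot f v ((1 / 2) ^ (k + k₀)) - dyadicDeriv f v) 1
          (volume.restrict (U : Set (E n)))) Filter.atTop (nhds 0) := by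
      simpa using ENNReal.Tendsto.const_mul hlim (Or.inr ENNReal.ofReal_ne_top)
    refine tendsto_of_tendsto_of_tendsto_of_le_of_le tendsto_const_nhds h3 (fun _ => zero_le)
      fun k => ?_
    simp only
    rw [eLpNorm_one_eq_lintegral_enorm, ← lintegral_const_mul' _ _ ENNReal.ofReal_ne_top]
    refine lintegral_mono fun x => ?_
    rw [← sub_mul, enorm_mul, mul_comm]
    refine mul_le_mul' ?_ le_rfl
    rw [← ofReal_norm]
    exact ENNReal.ofReal_le_ofReal (hφ x)
  have h3 := tendsto_nhds_unique h1 (h2.const_add _)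
  linarith

theorem locallyIntegrableOn_dyadicDeriv (hf : LocallyIntegrableOn f (Ω : Set (E n)) volume)
    (hv : ‖v‖ = 1) (hV0 : 0 ≤ V)
    (hV : ∀ (ψ : 𝓓(Ω, ℝ)) (c : ℝ), (∀ x, |ψ x| ≤ c) →
      ∫ x in (Ω : Set (E n)), f x * (∂_{v} (∂_{v} ψ)) x ≤ V * c) :
    LocallyIntegrableOn (dyadicDeriv f v) (Ω : Set (E n)) volume := by
  intro x hx
  obtain ⟨U, hxU, hc, hU⟩ := exists_opens_of_isCompact (isCompact_singleton (x := x))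
    (Set.singleton_subset_iff.2 hx)
  exact ⟨U, mem_nhdsWithin_of_mem_nhds (U.isOpen.mem_nhds (hxU rfl)),
    (integrableOn_dyadicDeriv_and_integral_eq hf hv hV0 hV hc hU).1⟩

theorem integral_mul_lineDerivOp_eq_neg (hf : LocallyIntegrableOn f (Ω : Set (E n)) volume)
    (hv : ‖v‖ = 1) (hV0 : 0 ≤ V)
    (hV : ∀ (ψ : 𝓓(Ω, ℝ)) (c : ℝ), (∀ x, |ψ x| ≤ c) →
      ∫ x in (Ω : Set (E n)), f x * (∂_{v} (∂_{v} ψ)) x ≤ V * c) (φ : 𝓓(Ω, ℝ)) :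
    ∫ x in (Ω : Set (E n)), f x * (∂_{v} φ) x =
      -∫ x in (Ω : Set (E n)), dyadicDeriv f v x * φ x := by
  obtain ⟨U, hφU, hc, hU⟩ := exists_opens_of_isCompact φ.hasCompactSupport.isCompact
    φ.tsupport_subset
  let ψ : 𝓓(U, ℝ) := ⟨φ, φ.contDiff, φ.hasCompactSupport, hφU⟩
  have hUΩ : U ≤ Ω := fun x hx => hU (subset_closure hx)
  have h1 := (integrableOn_dyadicDeriv_and_integral_eq hf hv hV0 hV hc hU).2 ψ
  rw [← setIntegral_testFunction_mul hUΩ] at h1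
  simp only [lineDerivOp_apply] at h1 ⊢
  exact h1

end WeakDerivative


/-! ### Dual norms and test fields. -/

section Fields

variable {n : ℕ} {A Ω : Opens (E n)}

theorem inner_toHS (M B : Matrix (Fin n) (Fin n) ℝ) :
    inner ℝ (toHS B) (toHS M) = ∑ i, ∑ j, M i j * B i j := by
  simp [PiLp.inner_apply, Fintype.sum_prod_type]

theorem norm_toHS (M : Matrix (Fin n) (Fin n) ℝ) : ‖toHS M‖ = √(∑ i, ∑ j, M i j ^ 2) := by
  simp [EuclideanSpace.norm_eq, Fintype.sum_prod_type]

theorem toHS_smul (t : ℝ) (M : Matrix (Fin n) (Fin n) ℝ) : toHS (t • M) = t • toHS M := rfl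

theorem ofReal_integral_le_lintegral_ofReal {X : Type*} [MeasurableSpace X] {μ : Measure X}
    {f : X → ℝ} (hf : Integrable f μ) :
    ENNReal.ofReal (∫ x, f x ∂μ) ≤ ∫⁻ x, ENNReal.ofReal (f x) ∂μ := by
  rw [integral_eq_lintegral_pos_part_sub_lintegral_neg_part hf]
  refine (ENNReal.ofReal_le_ofReal (sub_le_self _ ENNReal.toReal_nonneg)).trans ?_
  exact ENNReal.ofReal_toReal_le

/-- The field with the components of a smooth function with values in `MatHS n`. -/
noncomputable def fieldOfSmooth (φ : E n → MatHS n) (h : ContDiff ℝ (⊤ : ℕ∞) φ)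
    (hc : HasCompactSupport φ) (hA : tsupport φ ⊆ A) (i j : Fin n) : 𝓓(A, ℝ) :=
  ⟨fun x => φ x (i, j), (EuclideanSpace.proj (i, j) : MatHS n →L[ℝ] ℝ).contDiff.comp h,
    hc.comp_left (g := fun v : MatHS n => v (i, j)) rfl,
    (tsupport_comp_subset (g := fun v : MatHS n => v (i, j)) rfl φ).trans hA⟩

theorem integrable_inner_fieldAt {μ : Measure (E n)} {H : E n → Matrix (Fin n) (Fin n) ℝ}
    (hH : ∀ i j, Integrable (fun x => H x i j) μ) (F : Fin n → Fin n → 𝓓(A, ℝ)) :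
    Integrable (fun x => inner ℝ (toHS (fieldAt F x)) (toHS (H x))) μ := by
  simp only [inner_toHS]
  refine integrable_finsetSum _ fun i _ => integrable_finsetSum _ fun j _ => ?_
  obtain ⟨C, hC⟩ := exists_abs_testFunction_le (F i j)
  exact (hH i j).mul_bdd (F i j).aestronglyMeasurable (Filter.Eventually.of_forall hC)

/-- The supremum of the integrals of `⟨F, H⟩` over the test fields `F` in the unit ball of a norm is
the integral of the dual norm of `H`. -/
theorem iSup_ofReal_integral_inner_eq {μ : Measure (E n)} {H : E n → Matrix (Fin n) (Fin n) ℝ}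
    (hH : ∀ i j, Integrable (fun x => H x i j) μ) {N N' : Matrix (Fin n) (Fin n) ℝ → ℝ}
    (hN : ∀ t : ℝ, 0 ≤ t → ∀ M, N (t • M) ≤ t * N M) (hN' : ∀ M, 0 ≤ N' M)
    (hle : ∀ M B, ∑ i, ∑ j, M i j * B i j ≤ N' M * N B)
    (hex : ∀ M, ∃ B, N B ≤ 1 ∧ ∑ i, ∑ j, M i j * B i j = N' M) :
    ⨆ (F : Fin n → Fin n → 𝓓(A, ℝ)) (_ : ∀ x, N (fieldAt F x) ≤ 1),
      ENNReal.ofReal (∫ x in (A : Set (E n)), inner ℝ (toHS (fieldAt F x)) (toHS (H x)) ∂μ) =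
    ∫⁻ x in (A : Set (E n)), ENNReal.ofReal (N' (H x)) ∂μ := by
  apply le_antisymm
  · refine iSup₂_le fun F hF => ?_
    refine (ofReal_integral_le_lintegral_ofReal
      (integrable_inner_fieldAt (fun i j => (hH i j).restrict) F)).trans ?_
    refine lintegral_mono fun x => ENNReal.ofReal_le_ofReal ?_
    rw [inner_toHS]
    exact (hle _ _).trans (mul_le_of_le_one_right (hN' _) (hF x))
  set S := ⨆ (F : Fin n → Fin n → 𝓓(A, ℝ)) (_ : ∀ x, N (fieldAt F x) ≤ 1),
      ENNReal.ofReal (∫ x in (A : Set (E n)), inner ℝ (toHS (fieldAt F x)) (toHS (H x)) ∂μ) with hS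
  by_cases hST : S = ∞
  · rw [hST]
    exact le_top
  -- A dense sequence of the unit ball itself supplies the countable family. Because `⟨·, H x⟩` is
  -- continuous, its supremum over the sequence bounds its value at the norming matrix from `hex`.
  let B : Set (MatHS n) := {v | N (Matrix.of fun i j => v (i, j)) ≤ 1}
  have h0 : (0 : MatHS n) ∈ B := by
    have h := hN 0 le_rfl 0
    rw [zero_mul, zero_smul] at h
    exact h.trans zero_le_one
  have : Nonempty B := ⟨⟨0, h0⟩⟩
  have key := lintegral_iSup_inner_le_of_forall_contDiff (V := MatHS n)
    (μ := μ.restrict (A : Set (E n))) (H := fun x => toHS (H x))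
    (integrable_toHS hH).restrict A.isOpen (ae_restrict_mem A.isOpen.measurableSet) (B := B) h0
    (fun v hv t ht0 ht1 => (hN t ht0 _).trans
      ((mul_le_mul_of_nonneg_left hv ht0).trans (by simpa using ht1)))
    (fun k => (denseSeq B k : MatHS n)) (fun k => (denseSeq B k).2) S.toReal
    (fun φ h1 h2 h3 h4 => by
      have h5 : ENNReal.ofReal (∫ x in (A : Set (E n)), inner ℝ (φ x) (toHS (H x)) ∂μ) ≤ S :=
        le_iSup₂_of_le (fieldOfSmooth φ h1 h2 h3) h4 le_rfl
      exact (ENNReal.ofReal_le_iff_le_toReal hST).1 h5)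
  rw [ENNReal.ofReal_toReal hST] at key
  refine le_trans (lintegral_mono fun x => ?_) key
  obtain ⟨M, hM1, hM2⟩ := hex (H x)
  rw [← hM2, ← inner_toHS]
  have hclosed : IsClosed {v : B | ENNReal.ofReal (inner ℝ (v : MatHS n) (toHS (H x))) ≤
      ⨆ k, ENNReal.ofReal (inner ℝ (denseSeq B k : MatHS n) (toHS (H x)))} :=
    isClosed_le (ENNReal.continuous_ofReal.comp (by fun_prop)) continuous_const
  have hsub : closure (Set.range (denseSeq B)) ⊆ _ := closure_minimal (by
    rintro _ ⟨k, rfl⟩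
    exact le_iSup (fun k => ENNReal.ofReal (inner ℝ (denseSeq B k : MatHS n) (toHS (H x)))) k)
    hclosed
  exact hsub ((denseRange_denseSeq B) ⟨toHS M, hM1⟩)

/-- A functional on fields that is bounded on a unit ball. -/
theorem le_toReal_mul_of_forall_le {N : Matrix (Fin n) (Fin n) ℝ → ℝ}
    (hN : ∀ t : ℝ, 0 ≤ t → ∀ M, N (t • M) ≤ t * N M) {T : (Fin n → Fin n → 𝓓(A, ℝ)) → ℝ}
    (hT : ∀ (t : ℝ) F, T (fun i j => t • F i j) = t * T F)
    {S : ℝ≥0∞} (hST : S < ∞)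
    (hS : ∀ F : Fin n → Fin n → 𝓓(A, ℝ), (∀ x, N (fieldAt F x) ≤ 1) → ENNReal.ofReal (T F) ≤ S)
    (F : Fin n → Fin n → 𝓓(A, ℝ)) {R : ℝ} (hR : ∀ x, N (fieldAt F x) ≤ R) (hR0 : 0 ≤ R) :
    T F ≤ S.toReal * R := by
  -- Rescaling by `r > R` and letting `r` decrease to `R` also covers the case `R = 0`.
  have hpos : ∀ r : ℝ, R < r → T F ≤ S.toReal * r := by
    intro r hr
    have hr0 : 0 < r := hR0.trans_lt hr
    have h1 : ENNReal.ofReal (T fun i j => r⁻¹ • F i j) ≤ S := by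
      refine hS (fun i j => r⁻¹ • F i j) fun x => ?_
      have h2 : fieldAt (fun i j => r⁻¹ • F i j) x = r⁻¹ • fieldAt F x := rfl
      rw [h2]
      refine (hN _ (inv_nonneg.2 hr0.le) _).trans ?_
      rw [inv_mul_le_iff₀ hr0, mul_one]
      exact (hR x).trans hr.le
    have h3 := (ENNReal.ofReal_le_iff_le_toReal hST.ne).1 h1
    rwa [hT, inv_mul_le_iff₀ hr0, mul_comm] at h3
  have hlim : Filter.Tendsto (fun r : ℝ => S.toReal * r) (nhdsWithin R (Set.Ioi R))
      (nhds (S.toReal * R)) :=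
    ((continuous_const.mul continuous_id).tendsto R).mono_left nhdsWithin_le_nhds
  exact ge_of_tendsto hlim (Filter.eventually_of_mem self_mem_nhdsWithin hpos)

end Fields

/-! ### Integration by parts for test fields. -/

section Integration

variable {n : ℕ} {A Ω : Opens (E n)} {f : E n → ℝ} {g : E n → E n}

theorem IsWeakGradient.locallyIntegrableOn_apply (hg : IsWeakGradient Ω f g) (i : Fin n) :
    LocallyIntegrableOn (fun x => g x i) (Ω : Set (E n)) volume := by
  intro x hx
  obtain ⟨s, hs, h⟩ := hg.locallyIntegrable x hx
  exact ⟨s, hs, (EuclideanSpace.proj i : E n →L[ℝ] ℝ).integrable_comp h⟩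

theorem integral_sum_sum_mul {h : Fin n → Fin n → E n → ℝ}
    (hh : ∀ i j, LocallyIntegrableOn (h i j) (Ω : Set (E n)) volume) (hA : A ≤ Ω)
    (G : Fin n → Fin n → 𝓓(A, ℝ)) :
    ∫ x in (A : Set (E n)), ∑ i, ∑ j, h i j x * G i j x =
      ∑ i, ∑ j, ∫ x in (Ω : Set (E n)), h i j x * G i j x := by
  have hi : ∀ i j, Integrable (fun x => h i j x * G i j x) (volume.restrict (A : Set (E n))) :=
    fun i j => (integrable_mul_testFunction (hh i j) (extend hA (G i j))).restrict
  rw [integral_finsetSum _ fun i _ => integrable_finsetSum _ fun j _ => hi i j]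
  refine Finset.sum_congr rfl fun i _ => ?_
  rw [integral_finsetSum _ fun j _ => hi i j]
  exact Finset.sum_congr rfl fun j _ => (setIntegral_testFunction_mul hA _ _).symm

/-- The weak gradient identity is applied with the test function `∂_{e j} (F i j)`, extended to `Ω`.
-/
theorem IsWeakGradient.integral_hessian_eq (hf : LocallyIntegrableOn f (Ω : Set (E n)) volume)
    (hg : IsWeakGradient Ω f g) (hA : A ≤ Ω) (F : Fin n → Fin n → 𝓓(A, ℝ)) :
    ∫ x in (A : Set (E n)), ∑ i, ∑ j, f x * (∂_{e i} (∂_{e j} (F i j))) x =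
      -∫ x in (A : Set (E n)), ∑ i, ∑ j, g x i * (∂_{e j} (F i j)) x := by
  rw [integral_sum_sum_mul (h := fun _ _ => f) (fun _ _ => hf) hA
    fun i j => ∂_{e i} (∂_{e j} (F i j)),
    integral_sum_sum_mul (h := fun i _ x => g x i) (fun i _ => hg.locallyIntegrableOn_apply i) hA
    fun i j => ∂_{e j} (F i j)]
  simp only [← Finset.sum_neg_distrib]
  refine Finset.sum_congr rfl fun i _ => Finset.sum_congr rfl fun j _ => ?_
  have := hg.integral_eq (extend hA (∂_{e j} (F i j))) i
  simpa using this

theorem IsDistributionalDerivative.integral_eq_integral_inner {D : VectorMeasure (E n) (MatHS n)}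
    (hg : IsWeakGradient Ω f g) (hD : IsDistributionalDerivative Ω g D) (hA : A ≤ Ω)
    (F : Fin n → Fin n → 𝓓(A, ℝ)) :
    ∫ x in (A : Set (E n)), ∑ i, ∑ j, g x i * (∂_{e j} (F i j)) x =
      -∫ x in (A : Set (E n)), inner ℝ (toHS (fieldAt F x)) (toHS (polarDensity D x))
        ∂D.variation := by
  have := hD.finite
  have hint : ∀ i j, Integrable (fun x => polarDensity D x i j * F i j x) D.variation :=
    fun i j => by
      obtain ⟨C, hC⟩ := exists_abs_testFunction_le (F i j)
      exact (integrable_polarDensity D i j).mul_bdd (F i j).aestronglyMeasurable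
        (Filter.Eventually.of_forall hC)
  have hz : ∀ x, x ∉ (A : Set (E n)) →
      inner ℝ (toHS (fieldAt F x)) (toHS (polarDensity D x)) = 0 := fun x hx => by
    rw [inner_toHS]
    refine Finset.sum_eq_zero fun i _ => Finset.sum_eq_zero fun j _ => ?_
    rw [fieldAt, Matrix.of_apply, testFunction_eq_zero hx, mul_zero]
  rw [integral_sum_sum_mul (h := fun i _ x => g x i) (fun i _ => hg.locallyIntegrableOn_apply i) hA
    fun i j => ∂_{e j} (F i j), setIntegral_eq_integral_of_forall_compl_eq_zero hz]
  simp only [inner_toHS, fieldAt, Matrix.of_apply]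
  rw [integral_finsetSum _ fun i _ => integrable_finsetSum _ fun j _ => hint i j,
    ← Finset.sum_neg_distrib]
  refine Finset.sum_congr rfl fun i _ => ?_
  rw [integral_finsetSum _ fun j _ => hint i j, ← Finset.sum_neg_distrib]
  refine Finset.sum_congr rfl fun j _ => ?_
  have := hD.integral_eq (extend hA (F i j)) i j
  rw [integral_testFunction_apply] at this
  simpa [mul_comm] using this

end Integration


/-! ### The two variations, existence of the derivatives, and comparison of the measures. -/

section Variations

variable {n : ℕ} {A Ω : Opens (E n)} {f : E n → ℝ} {g : E n → E n} {p : ℝ≥0∞}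

theorem sum_mul_le_norm_mul_norm_toHS (M B : Matrix (Fin n) (Fin n) ℝ) :
    ∑ i, ∑ j, M i j * B i j ≤ ‖toHS M‖ * ‖toHS B‖ := by
  rw [← inner_toHS, mul_comm]
  exact real_inner_le_norm _ _

theorem exists_norm_toHS_le_one_sum_mul_eq (M : Matrix (Fin n) (Fin n) ℝ) :
    ∃ B, ‖toHS B‖ ≤ 1 ∧ ∑ i, ∑ j, M i j * B i j = ‖toHS M‖ := by
  refine ⟨‖toHS M‖⁻¹ • M, ?_, ?_⟩
  · rw [toHS_smul, norm_smul, norm_inv, norm_norm]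
    exact inv_mul_le_one
  · rw [← inner_toHS, toHS_smul, real_inner_smul_left, real_inner_self_eq_norm_sq]
    rcases eq_or_ne ‖toHS M‖ 0 with h | h
    · simp [h]
    · field_simp

theorem norm_toHS_smul_le (t : ℝ) (ht : 0 ≤ t) (M : Matrix (Fin n) (Fin n) ℝ) :
    ‖toHS (t • M)‖ ≤ t * ‖toHS M‖ := by
  rw [toHS_smul, norm_smul, Real.norm_of_nonneg ht]

theorem norm_toHS_le_schattenNorm (hp : 1 ≤ p) (M : Matrix (Fin n) (Fin n) ℝ) :
    ‖toHS M‖ ≤ n * schattenNorm p M :=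
  (norm_toHS M).trans_le (sqrt_sum_sq_le_schattenNorm hp M)

theorem schattenNorm_le_norm_toHS (hp : 1 ≤ p) (M : Matrix (Fin n) (Fin n) ℝ) :
    schattenNorm p M ≤ n * ‖toHS M‖ := by
  rw [norm_toHS]
  exact schattenNorm_le_sqrt_sum_sq hp M

/-- The total variation of a vector field is the variation measure of its derivative. -/
theorem IsDistributionalDerivative.totalVariation_eq {D : VectorMeasure (E n) (MatHS n)}
    (hg : IsWeakGradient Ω f g) (hD : IsDistributionalDerivative Ω g D) (hA : A ≤ Ω) :
    totalVariation g A = D.variation A := by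
  have := hD.finite
  -- The sign of `H` accounts for the single integration by parts; for the Hessian there are two,
  -- and the signs cancel.
  have h1 := iSup_ofReal_integral_inner_eq (A := A) (μ := D.variation)
    (H := fun x => -polarDensity D x) (fun i j => (integrable_polarDensity D i j).neg)
    (N := fun M => ‖toHS M‖) (N' := fun M => ‖toHS M‖) norm_toHS_smul_le
    (fun _ => norm_nonneg _) sum_mul_le_norm_mul_norm_toHS exists_norm_toHS_le_one_sum_mul_eq
  have h2 : ∀ x, toHS (-polarDensity D x) = -toHS (polarDensity D x) := fun x => rfl
  simp only [h2, inner_neg_right, integral_neg, norm_neg, ofReal_norm] at h1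
  have h3 : D.variation A = ∫⁻ x in (A : Set (E n)), ‖toHS (polarDensity D x)‖ₑ ∂D.variation := by
    rw [← withDensity_apply _ A.isOpen.measurableSet, ← variation_eq_withDensity]
  rw [h3, ← h1, totalVariation]
  simp only [hD.integral_eq_integral_inner hg hA]
  rfl

/-- The Hessian-Schatten variation as an integral with respect to the polar decomposition. -/
theorem IsDistributionalDerivative.hessianSchattenVariation_eq
    {D : VectorMeasure (E n) (MatHS n)} (hp : 1 ≤ p)
    (hf : LocallyIntegrableOn f (Ω : Set (E n)) volume)
    (hg : IsWeakGradient Ω f g) (hD : IsDistributionalDerivative Ω g D) (hA : A ≤ Ω) :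
    hessianSchattenVariation p f A =
      (D.variation.withDensity fun x => ENNReal.ofReal (schattenNorm p (polarDensity D x))) A := by
  have h := ENNReal.HolderConjugate.conjExponent hp
  have h1 := iSup_ofReal_integral_inner_eq (A := A) (μ := D.variation)
    (H := polarDensity D) (integrable_polarDensity D)
    (N := schattenNorm (ENNReal.conjExponent p)) (N' := schattenNorm p)
    (fun t ht M => schattenNorm_smul_le h.symm ht M)
    (schattenNorm_nonneg hp) (sum_mul_le_schattenNorm_mul h)
    (exists_schattenNorm_le_one_sum_mul_eq h)
  rw [withDensity_apply _ A.isOpen.measurableSet, ← h1, hessianSchattenVariation]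
  simp only [hg.integral_hessian_eq hf hA, hD.integral_eq_integral_inner hg hA, neg_neg]

theorem lineDerivOp_smul_apply (t : ℝ) (φ : 𝓓(A, ℝ)) (v x : E n) :
    (∂_{v} (t • φ)) x = t * (∂_{v} φ) x := by
  rw [show (∂_{v} (t • φ) : 𝓓(A, ℝ)) = t • (∂_{v} φ : 𝓓(A, ℝ)) from
    LineDeriv.lineDerivOp_smul v t φ]
  rfl

theorem lineDerivOp_lineDerivOp_smul_apply (t : ℝ) (φ : 𝓓(A, ℝ)) (v w x : E n) :
    (∂_{v} (∂_{w} (t • φ))) x = t * (∂_{v} (∂_{w} φ)) x := by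
  rw [show (∂_{w} (t • φ) : 𝓓(A, ℝ)) = t • (∂_{w} φ : 𝓓(A, ℝ)) from
    LineDeriv.lineDerivOp_smul w t φ, lineDerivOp_smul_apply]

theorem integral_hessian_le (hp : 1 ≤ p) (h : hessianSchattenVariation p f Ω < ∞)
    (F : Fin n → Fin n → 𝓓(Ω, ℝ)) {R : ℝ} (hR : ∀ x, ‖toHS (fieldAt F x)‖ ≤ R) (hR0 : 0 ≤ R) :
    ∫ x in (Ω : Set (E n)), ∑ i, ∑ j, f x * (∂_{e i} (∂_{e j} (F i j))) x ≤
      (hessianSchattenVariation p f Ω).toReal * (n * R) := by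
  have hpq := ENNReal.HolderConjugate.conjExponent hp
  refine le_toReal_mul_of_forall_le (R := n * R) (N := schattenNorm (ENNReal.conjExponent p))
    (T := fun F => ∫ x in (Ω : Set (E n)), ∑ i, ∑ j, f x * (∂_{e i} (∂_{e j} (F i j))) x)
    (fun t ht M => schattenNorm_smul_le hpq.symm ht M) (fun t F => ?_) h
    (fun F hF => le_iSup₂_of_le F hF le_rfl) F (fun x => ?_)
    (by positivity)
  · rw [← integral_const_mul]
    refine integral_congr_ae (Filter.Eventually.of_forall fun x => ?_)
    simp only [lineDerivOp_lineDerivOp_smul_apply, Finset.mul_sum]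
    exact Finset.sum_congr rfl fun i _ => Finset.sum_congr rfl fun j _ => by ring
  · have hq : 1 ≤ ENNReal.conjExponent p := @ENNReal.HolderConjugate.one_le _ p hpq.symm
    exact (schattenNorm_le_norm_toHS hq _).trans (by gcongr; exact hR x)

theorem integral_jacobian_le (h : totalVariation g Ω < ∞)
    (F : Fin n → Fin n → 𝓓(Ω, ℝ)) {R : ℝ} (hR : ∀ x, ‖toHS (fieldAt F x)‖ ≤ R) (hR0 : 0 ≤ R) :
    ∫ x in (Ω : Set (E n)), ∑ i, ∑ j, g x i * (∂_{e j} (F i j)) x ≤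
      (totalVariation g Ω).toReal * R := by
  refine le_toReal_mul_of_forall_le (N := fun M => ‖toHS M‖)
    (T := fun F => ∫ x in (Ω : Set (E n)), ∑ i, ∑ j, g x i * (∂_{e j} (F i j)) x)
    norm_toHS_smul_le (fun t F => ?_) h
    (fun F hF => le_iSup₂_of_le F hF le_rfl) F hR hR0
  rw [← integral_const_mul]
  refine integral_congr_ae (Filter.Eventually.of_forall fun x => ?_)
  simp only [lineDerivOp_smul_apply, Finset.mul_sum]
  exact Finset.sum_congr rfl fun i _ => Finset.sum_congr rfl fun j _ => by ring

/-- The field with a single nonzero entry. -/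
noncomputable def singleField (φ : 𝓓(A, ℝ)) (i j : Fin n) (k l : Fin n) : 𝓓(A, ℝ) :=
  if i = k ∧ j = l then φ else 0

theorem norm_toHS_singleField (φ : 𝓓(A, ℝ)) (i j : Fin n) (x : E n) :
    ‖toHS (fieldAt (singleField φ i j) x)‖ = |φ x| := by
  have h : toHS (fieldAt (singleField φ i j) x) = EuclideanSpace.single (i, j) (φ x) := by
    ext ⟨k, l⟩
    simp only [toHS_apply, fieldAt, Matrix.of_apply, singleField, PiLp.single_apply, Prod.mk.injEq,
      eq_comm (a := k), eq_comm (a := l)]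
    split_ifs <;> rfl
  rw [h, PiLp.norm_single, Real.norm_eq_abs]

/-- A field with a single entry `φ` has Hilbert-Schmidt norm `|φ|`, so each second derivative of `f`
is a functional bounded for the supremum norm. The factor `n` comes from comparing with the Schatten
norm. -/
theorem integral_lineDerivOp_lineDerivOp_le (hp : 1 ≤ p)
    (h : hessianSchattenVariation p f Ω < ∞) (i j : Fin n) (φ : 𝓓(Ω, ℝ)) {c : ℝ}
    (hc : ∀ x, |φ x| ≤ c) :
    ∫ x in (Ω : Set (E n)), f x * (∂_{e i} (∂_{e j} φ)) x ≤
      (hessianSchattenVariation p f Ω).toReal * n * c := by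
  have h1 := integral_hessian_le hp h (singleField φ i j)
    (fun x => (norm_toHS_singleField φ i j x).trans_le (hc x)) ((abs_nonneg _).trans (hc 0))
  rw [mul_assoc]
  refine le_trans (le_of_eq ?_) h1
  refine integral_congr_ae (Filter.Eventually.of_forall fun x => ?_)
  have h0 : ∀ k l, (∂_{e k} (∂_{e l} (singleField φ i j k l))) x =
      if i = k then (if j = l then (∂_{e i} (∂_{e j} φ)) x else 0) else 0 := fun k l => by
    by_cases hk : i = k
    · by_cases hl : j = l
      · subst hk hl
        simp [singleField]
      · simp only [singleField, hl, and_false, if_false, LineDeriv.lineDerivOp_zero, ite_self]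
        rfl
    · simp only [singleField, hk, false_and, if_false, LineDeriv.lineDerivOp_zero]
      rfl
  simp [h0]

/-- Only the pure second derivatives `∂_i ∂_i f` enter: each controls the difference quotients in
its own direction. -/
theorem exists_isWeakGradient (hp : 1 ≤ p) (hf : LocallyIntegrableOn f (Ω : Set (E n)) volume)
    (h : hessianSchattenVariation p f Ω < ∞) : ∃ g, IsWeakGradient Ω f g := by
  have hv : ∀ i : Fin n, ‖(e i : E n)‖ = 1 := fun i => by simp
  have hV : ∀ (i : Fin n) (ψ : 𝓓(Ω, ℝ)) (c : ℝ), (∀ x, |ψ x| ≤ c) →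
      ∫ x in (Ω : Set (E n)), f x * (∂_{e i} (∂_{e i} ψ)) x ≤
        (hessianSchattenVariation p f Ω).toReal * n * c :=
    fun i ψ c hc => integral_lineDerivOp_lineDerivOp_le hp h i i ψ hc
  have hV0 : 0 ≤ (hessianSchattenVariation p f Ω).toReal * n := by positivity
  refine ⟨fun x => WithLp.toLp 2 fun i => dyadicDeriv f (e i) x, ?_, fun φ i => ?_⟩
  · intro x hx
    have h1 : ∀ i : Fin n, IntegrableAtFilter (dyadicDeriv f (e i))
        (nhdsWithin x (Ω : Set (E n))) volume :=
      fun i => locallyIntegrableOn_dyadicDeriv hf (hv i) hV0 (hV i) x hx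
    choose s hs hint using h1
    refine ⟨⋂ i, s i, Filter.iInter_mem.2 hs, ?_⟩
    refine (PiLp.continuousLinearEquiv 2 ℝ
      fun _ : Fin n => ℝ).symm.toContinuousLinearMap.integrable_comp
      (φ := fun x i => dyadicDeriv f (e i) x) ?_
    exact Integrable.of_eval fun i => (hint i).mono_set (Set.iInter_subset _ i)
  · exact integral_mul_lineDerivOp_eq_neg hf (hv i) hV0 (hV i) φ

/-- The entries of `D` represent the functionals `φ ↦ ∫ f ∂_i ∂_j φ`. Testing the weak gradient with
`∂_j φ` identifies them with the derivatives of `g`. -/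
theorem IsWeakGradient.exists_isDistributionalDerivative (hp : 1 ≤ p)
    (hf : LocallyIntegrableOn f (Ω : Set (E n)) volume)
    (hg : IsWeakGradient Ω f g) (h : hessianSchattenVariation p f Ω < ∞) :
    ∃ D, IsDistributionalDerivative Ω g D := by
  have hint : ∀ φ : 𝓓(Ω, ℝ), Integrable (fun x => f x * φ x) (volume.restrict (Ω : Set (E n))) :=
    fun φ => (integrable_mul_testFunction hf φ).restrict
  let L : Fin n → Fin n → 𝓓(Ω, ℝ) →ₗ[ℝ] ℝ := fun i j =>
    { toFun := fun φ => ∫ x in (Ω : Set (E n)), f x * (∂_{e i} (∂_{e j} φ)) x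
      map_add' := fun φ ψ => by
        rw [← integral_add (hint _) (hint _)]
        refine integral_congr_ae (Filter.Eventually.of_forall fun x => ?_)
        simp only [LineDeriv.lineDerivOp_add]
        exact mul_add _ _ _
      map_smul' := fun t φ => by
        rw [RingHom.id_apply, smul_eq_mul, ← integral_const_mul]
        refine integral_congr_ae (Filter.Eventually.of_forall fun x => ?_)
        simp only [lineDerivOp_lineDerivOp_smul_apply]
        ring }
  have hL : ∀ i j, ∃ μ ν : Measure (E n), IsFiniteMeasure μ ∧ IsFiniteMeasure ν ∧
      ∀ φ, L i j φ = ∫ x, φ x ∂μ - ∫ x, φ x ∂ν := fun i j =>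
    exists_measure_sub_of_forall_le (L i j) ((hessianSchattenVariation p f Ω).toReal * n)
      fun φ c hc => integral_lineDerivOp_lineDerivOp_le hp h i j φ hc
  choose μ ν hμ hν hμν using hL
  obtain ⟨D, hD1, hD2, hD3⟩ := exists_vectorMeasure Ω μ ν hμ hν
  refine ⟨D, hD1, hD2, fun φ i j => ?_⟩
  rw [hD3, ← hμν]
  have := hg.integral_eq (∂_{e j} φ) i
  change _ = -∫ x in (Ω : Set (E n)), f x * (∂_{e i} (∂_{e j} φ)) x
  rw [this, neg_neg]

/-- Finite measures that agree on the π-system of open sets coincide. Both measures live on `Ω`, so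
an open set may be intersected with `Ω`. Uniqueness transfers the density formula to an arbitrary
`m`. -/
theorem IsHessianSchattenMeasure.eq {m m' : Measure (E n)} (h : IsHessianSchattenMeasure p f Ω m)
    (h' : IsHessianSchattenMeasure p f Ω m') : m = m' := by
  have := h.finite
  have hopen : ∀ s : Set (E n), IsOpen s → m s = m' s := fun s hs => by
    rw [← measure_inter_conull h.concentrated, ← measure_inter_conull h'.concentrated]
    have h1 := h.apply_open (⟨s, hs⟩ ⊓ Ω) inf_le_right
    have h2 := h'.apply_open (⟨s, hs⟩ ⊓ Ω) inf_le_right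
    exact h1.trans h2.symm
  exact ext_of_generate_finite {s | IsOpen s} (BorelSpace.measurable_eq.trans rfl) isPiSystem_isOpen
    hopen (hopen _ isOpen_univ)

theorem IsDistributionalDerivative.isHessianSchattenMeasure {D : VectorMeasure (E n) (MatHS n)}
    (hp : 1 ≤ p) (hf : LocallyIntegrableOn f (Ω : Set (E n)) volume) (hg : IsWeakGradient Ω f g)
    (h : hessianSchattenVariation p f Ω < ∞) (hD : IsDistributionalDerivative Ω g D) :
    IsHessianSchattenMeasure p f Ω (D.variation.withDensity fun x =>
      ENNReal.ofReal (schattenNorm p (polarDensity D x))) := by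
  have hc : (D.variation.withDensity fun x =>
      ENNReal.ofReal (schattenNorm p (polarDensity D x))) (Ω : Set (E n))ᶜ = 0 :=
    withDensity_absolutelyContinuous _ _ hD.concentrated
  refine ⟨⟨?_⟩, hc, fun A hA => (hD.hessianSchattenVariation_eq hp hf hg hA).symm⟩
  rw [← Set.union_compl_self (Ω : Set (E n))]
  refine (measure_union_le _ _).trans_lt ?_
  rw [hc, add_zero, ← hD.hessianSchattenVariation_eq hp hf hg le_rfl]
  exact h

theorem withDensity_schattenNorm_le (hp : 1 ≤ p) (D : VectorMeasure (E n) (MatHS n))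
    [IsFiniteMeasure D.variation] :
    D.variation.withDensity (fun x => ENNReal.ofReal (schattenNorm p (polarDensity D x))) ≤
      (n + 1 : ℝ≥0) • D.variation := by
  refine Measure.le_iff.2 fun s hs => ?_
  conv_rhs => rw [variation_eq_withDensity D]
  rw [Measure.smul_apply, withDensity_apply _ hs, withDensity_apply _ hs, ENNReal.smul_def,
    smul_eq_mul, ← lintegral_const_mul' _ _ ENNReal.coe_ne_top]
  refine lintegral_mono fun x => ?_
  rw [← ofReal_norm, ← ENNReal.ofReal_coe_nnreal, ← ENNReal.ofReal_mul (by positivity)]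
  refine ENNReal.ofReal_le_ofReal ((schattenNorm_le_norm_toHS hp _).trans ?_)
  push_cast
  gcongr
  linarith

theorem le_withDensity_schattenNorm (hp : 1 ≤ p) (D : VectorMeasure (E n) (MatHS n))
    [IsFiniteMeasure D.variation] :
    (n + 1 : ℝ≥0)⁻¹ • D.variation ≤
      D.variation.withDensity fun x => ENNReal.ofReal (schattenNorm p (polarDensity D x)) := by
  have h : D.variation ≤ (n + 1 : ℝ≥0) •
      D.variation.withDensity fun x => ENNReal.ofReal (schattenNorm p (polarDensity D x)) := by
    refine Measure.le_iff.2 fun s hs => ?_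
    conv_lhs => rw [variation_eq_withDensity D]
    rw [Measure.smul_apply, withDensity_apply _ hs, withDensity_apply _ hs, ENNReal.smul_def,
      smul_eq_mul, ← lintegral_const_mul' _ _ ENNReal.coe_ne_top]
    refine lintegral_mono fun x => ?_
    rw [← ofReal_norm, ← ENNReal.ofReal_coe_nnreal, ← ENNReal.ofReal_mul (by positivity)]
    refine ENNReal.ofReal_le_ofReal ((norm_toHS_le_schattenNorm hp _).trans ?_)
    have := schattenNorm_nonneg hp (polarDensity D x)
    push_cast
    gcongr
    linarith
  refine Measure.le_iff.2 fun s hs => ?_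
  have h1 := h s
  rw [Measure.smul_apply, ENNReal.smul_def, smul_eq_mul] at h1 ⊢
  rw [ENNReal.coe_inv (by positivity)]
  exact ENNReal.inv_mul_le_iff (by simp) (by simp) |>.2 h1

end Variations

end HessianSchatten

theorem proposition3p2 (n : ℕ) (p : ℝ≥0∞) (hp : 1 ≤ p) :
    ∃ C : ℝ≥0, 0 < C ∧
      ∀ (Ω : Opens (HessianSchatten.E n)) (f : HessianSchatten.E n → ℝ),
        LocallyIntegrableOn f (Ω : Set (HessianSchatten.E n)) volume →
        (HessianSchatten.HasBoundedHessianSchattenVariation p f Ω ↔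
          ∃ g : HessianSchatten.E n → HessianSchatten.E n,
            HessianSchatten.IsWeakGradient Ω f g ∧ HessianSchatten.MemBVLoc g Ω ∧
              HessianSchatten.totalVariation g Ω < ∞) ∧
        (HessianSchatten.HasBoundedHessianSchattenVariation p f Ω →
          (∃ m, HessianSchatten.IsHessianSchattenMeasure p f Ω m) ∧
          ∀ g : HessianSchatten.E n → HessianSchatten.E n,
            HessianSchatten.IsWeakGradient Ω f g →
            (∃ D, HessianSchatten.IsDistributionalDerivative Ω g D) ∧
            ∀ D, HessianSchatten.IsDistributionalDerivative Ω g D →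
              (∀ A : Opens (HessianSchatten.E n), A ≤ Ω →
                D.variation (A : Set (HessianSchatten.E n)) =
                  HessianSchatten.totalVariation g A) ∧
              ∀ m, HessianSchatten.IsHessianSchattenMeasure p f Ω m →
                m = D.variation.withDensity (fun x =>
                  ENNReal.ofReal
                    (HessianSchatten.schattenNorm p (HessianSchatten.polarDensity D x))) ∧
                C⁻¹ • D.variation ≤ m ∧ m ≤ C • D.variation) := by
  -- The norm comparisons hold with `n`; `n + 1` stays positive when `n = 0`.
  refine ⟨n + 1, by positivity, fun Ω f hf => ⟨⟨fun h => ?_, ?_⟩, fun h => ?_⟩⟩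
  · obtain ⟨g, hg⟩ := HessianSchatten.exists_isWeakGradient hp hf h
    obtain ⟨D, hD⟩ := hg.exists_isDistributionalDerivative hp hf h
    have := hD.finite
    have hfin : ∀ A ≤ Ω, HessianSchatten.totalVariation g A < ∞ := fun A hA => by
      rw [hD.totalVariation_eq hg hA]
      exact measure_lt_top _ _
    exact ⟨g, hg, ⟨hg.locallyIntegrable, fun A _ hA =>
      hfin A fun x hx => hA (subset_closure hx)⟩, hfin Ω le_rfl⟩
  · rintro ⟨g, hg, -, hgΩ⟩
    have hq : 1 ≤ ENNReal.conjExponent p :=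
      @ENNReal.HolderConjugate.one_le _ p (ENNReal.HolderConjugate.conjExponent hp).symm
    refine (iSup₂_le fun F hF => ENNReal.ofReal_le_ofReal ?_ :
      HessianSchatten.hessianSchattenVariation p f Ω ≤ ENNReal.ofReal
        ((HessianSchatten.totalVariation g Ω).toReal * n)).trans_lt ENNReal.ofReal_lt_top
    rw [hg.integral_hessian_eq hf le_rfl]
    -- The field `-F` absorbs the sign of the integration by parts. Its Hilbert-Schmidt norm is at
    -- most `n` because the dual Schatten norm of `F` is at most `1`.
    have h1 := HessianSchatten.integral_jacobian_le hgΩ (fun i j => (-1 : ℝ) • F i j) (R := n)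
      (fun x => by
        rw [show HessianSchatten.toHS (HessianSchatten.fieldAt (fun i j => (-1 : ℝ) • F i j) x) =
          (-1 : ℝ) • HessianSchatten.toHS (HessianSchatten.fieldAt F x) from rfl, norm_smul]
        have := (HessianSchatten.norm_toHS_le_schattenNorm hq (HessianSchatten.fieldAt F x)).trans
          (mul_le_of_le_one_right (by positivity) (hF x))
        simpa using this) (by positivity)
    refine le_trans (le_of_eq ?_) h1
    rw [← integral_neg]
    refine integral_congr_ae (Filter.Eventually.of_forall fun x => ?_)
    simp only [HessianSchatten.lineDerivOp_smul_apply, ← Finset.sum_neg_distrib]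
    exact Finset.sum_congr rfl fun i _ => Finset.sum_congr rfl fun j _ => by ring
  · obtain ⟨g₀, hg₀⟩ := HessianSchatten.exists_isWeakGradient hp hf h
    obtain ⟨D₀, hD₀⟩ := hg₀.exists_isDistributionalDerivative hp hf h
    refine ⟨⟨_, hD₀.isHessianSchattenMeasure hp hf hg₀ h⟩, fun g hg =>
      ⟨hg.exists_isDistributionalDerivative hp hf h, fun D hD =>
        ⟨fun A hA => (hD.totalVariation_eq hg hA).symm, fun m hm => ?_⟩⟩⟩
    have := hD.finite
    rw [hm.eq (hD.isHessianSchattenMeasure hp hf hg h)]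
    exact ⟨rfl, HessianSchatten.le_withDensity_schattenNorm hp D,
      HessianSchatten.withDensity_schattenNorm_le hp D⟩
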